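/- Let $\xi$ be a probability measure on $\{0,1,2,\dots\}$ with $\sum_k k\,\xi(k)\le 1$ and $\xi(1)<1$, and for every $k\ge 0$ let $\eta^{(k)}$ be a probability measure on $\{-1,0,1\}^k$. A labelled plane tree is a finite rooted plane tree with vertices labelled by integers such that labels differ by $-1$, $0$ or $1$ along each edge. Let $\Pi_x$ be the law of the labelled Galton–Watson tree rooted at label $x$: each tree $t$ whose root has label $x$ has mass $$\Pi_x(t)=\prod_{v}\xi(k_v)\,\eta^{(k_v)}([v]),$$ where $v$ ranges over the vertices of $t$, $k_v$ is the number of children of $v$, and $[v]$ is the vector of the label increments from $v$ to its children, listed from left to right. The truncation $t^{[l]}$ of a tree $t$ at level $l$ is obtained by deleting all vertices that have a strict ancestor with label $l$. Let $\Pi^+$ be the law of the truncation at level $0$ of a tree with law $\Pi_1$, and for a tree $\tau$ let $n_\tau$ be the number of its vertices with label $0$. Let $T$ be a random labelled plane tree with law $\Pi_0$. For $m\ge 1$, let $X_m^+$ (resp. $X_m^-$) be the number of edges of $T$, oriented from parent to child, from a vertex labelled $m-1$ to a vertex labelled $m$ (resp. from $m$ to $m-1$). Cut every such edge (of either kind)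 at its endpoint $v$ that is the child, duplicating $v$: one copy of $v$ becomes the root of the part made of $v$ and its descendants, and the other copy becomes a leaf of the remaining part. The resulting components, apart from the one containing the root of $T$, which is the root component $T^{[m]}$, are rooted at label $m$ or at label $m-1$. Let $\mathcal P_m$ be the multiset of the $X_m^+$ components rooted at label $m$, with $m-1$ subtracted from all labels (the positive tree excursions), and let $\mathcal N_m$ be the multiset of the $X_m^-$ components rooted at label $m-1$, with $m$ subtracted from all labels (the negative tree excursions). Then for all $m\ge 1$ and $p,q\ge 0$ with $\mathbb P(X_m^+=p,\ X_m^-=q)>0$, conditionally on $\{X_m^+=p,\ X_m^-=q\}$: 1. $\mathcal P_m$ is independent of the pair $(T^{[m]},\mathcal N_m)$; 2. $\mathcal P_m$ has the law of the multiset $\{\tau_1,\dots,\tau_p\}$, where $\tau_1,\dots,\tau_p$ are independent with law $\Pi^+$, conditioned on the event $\{n_{\tau_1}+\dots+n_{\tau_p}=q\}$. In particular, $(X_m^+,X_m^-)_{m\ge 1}$ is a time-homogeneous Markov chain. -/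

import Mathlib

open MeasureTheory ProbabilityTheory

/-- A finite rooted plane tree whose vertices carry integer labels: `node x k c` has root label `x`,
and its root has `k` children, listed from left to right, the subtree branching off the `i`-th child
being `c i`. The constraint on the labels along edges is `HasUnitIncrements`. -/
inductive LabelledTree : Type
  | node (x : ℤ) (k : ℕ) (c : Fin k → LabelledTree) : LabelledTree

namespace LabelledTree

/-- Trees form a countable set, equipped with its discrete σ-algebra. -/
instance : MeasurableSpace LabelledTree := ⊤

/-- The label of the root. -/
def rootLabel : LabelledTree → ℤ
  | node x _ _ => x

/-- Labels vary by `-1`, `0` or `1` along each edge. -/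
def HasUnitIncrements : LabelledTree → Prop
  | node x _ c => ∀ i, (c i).rootLabel - x ∈ ({-1, 0, 1} : Set ℤ) ∧ (c i).HasUnitIncrements

/-- The set of labelled plane trees rooted at `x`. -/
def rootedAt (x : ℤ) : Set LabelledTree := {t | t.HasUnitIncrements ∧ t.rootLabel = x}

/-- The tree reduced to a single vertex with label `x`. -/
def leaf (x : ℤ) : LabelledTree := node x 0 Fin.elim0

/-- Adds `s` to every label. -/
def shift (s : ℤ) : LabelledTree → LabelledTree
  | node x k c => node (x + s) k fun i => shift s (c i)

/-- The truncation at level `l`: delete the vertices that have a strict ancestor of label `l`. -/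
def truncate (l : ℤ) : LabelledTree → LabelledTree
  | node x k c => if x = l then leaf x else node x k fun i => truncate l (c i)

/-- The number of vertices with label `a`. -/
def labelCount (a : ℤ) : LabelledTree → ℕ
  | node x _ c => (if x = a then 1 else 0) + ∑ i, labelCount a (c i)

/-- The number of edges, oriented from parent to child, from a vertex with label `a` to a vertex with
label `b`. -/
def edgeCount (a b : ℤ) : LabelledTree → ℕ
  | node x _ c => ∑ i, ((if x = a ∧ (c i).rootLabel = b then 1 else 0) + edgeCount a b (c i))

/-- The edge profile `(X_m^+, X_m^-)` at level `m`: the numbers of oriented edges from label `m - 1`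
to label `m`, and from label `m` to label `m - 1`. -/
def edgeProfile (m : ℤ) (t : LabelledTree) : ℕ × ℕ :=
  (edgeCount (m - 1) m t, edgeCount m (m - 1) t)

/-- Cut all edges of the tree between the labels `m - 1` and `m` (in either direction). Each cut
disconnects the tree at the lower endpoint (the child), which is duplicated: one copy is kept, as a
leaf, with the part above it. This is the component containing the root of the tree. -/
def component (m : ℤ) : LabelledTree → LabelledTree
  | node x k c => node x k fun i =>
      if (x = m - 1 ∧ (c i).rootLabel = m) ∨ (x = m ∧ (c i).rootLabel = m - 1) then
        leaf (c i).rootLabel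
      else component m (c i)

/-- The multiset of positive tree excursions at level `m`: for each edge from a vertex labelled
`m - 1` to a child `v` labelled `m`, the component rooted at `v`, with `m - 1` subtracted from all
labels. -/
def positiveExcursions (m : ℤ) : LabelledTree → Multiset LabelledTree
  | node x _ c => ∑ i, ((if x = m - 1 ∧ (c i).rootLabel = m then
        {shift (-(m - 1)) (component m (c i))} else 0) + positiveExcursions m (c i))

/-- The multiset of negative tree excursions at level `m`: for each edge from a vertex labelled
`m` to a child `v` labelled `m - 1`, the component rooted at `v`, with `m` subtracted from all
labels. -/
def negativeExcursions (m : ℤ) : LabelledTree → Multiset LabelledTree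
  | node x _ c => ∑ i, ((if x = m ∧ (c i).rootLabel = m - 1 then
        {shift (-m) (component m (c i))} else 0) + negativeExcursions m (c i))

/-- The product over all vertices `v` of `ξ (k v) * η (k v) [v]`, where `k v` is the number of
children of `v` and `[v]` is the vector of the label increments from `v` to its children. -/
noncomputable def weight (ξ : PMF ℕ) (η : (k : ℕ) → PMF (Fin k → ℤ)) : LabelledTree → ENNReal
  | node x k c => ξ k * η k (fun i => (c i).rootLabel - x) * ∏ i, weight ξ η (c i)

/-- The law of the labelled Galton–Watson tree rooted at `x` with offspring distribution `ξ` and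
displacement distributions `η`: it gives mass `weight ξ η t` to each labelled plane tree `t`
rooted at `x`. -/
noncomputable def galtonWatsonLaw (ξ : PMF ℕ) (η : (k : ℕ) → PMF (Fin k → ℤ)) (x : ℤ) :
    Measure LabelledTree :=
  (Measure.sum fun t : LabelledTree => weight ξ η t • Measure.dirac t).restrict (rootedAt x)

/-- The law of a positive excursion: the law of the truncation at level `0` of a labelled
Galton–Watson tree rooted at `1`. -/
noncomputable def positiveExcursionLaw (ξ : PMF ℕ) (η : (k : ℕ) → PMF (Fin k → ℤ)) :
    Measure LabelledTree :=
  (galtonWatsonLaw ξ η 1).map (truncate 0)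

end LabelledTree

/-- Finite multisets of trees form a countable set, equipped with its discrete σ-algebra. -/
instance : MeasurableSpace (Multiset LabelledTree) := ⊤

/-- `Y 0, Y 1, …` is a time-homogeneous Markov chain in the countable state space `S`: there is a
transition kernel `κ` such that, given any past of positive probability, the conditional
law of `Y (n + 1)` is `κ (Y n)`. -/
def IsTimeHomogeneousMarkovChain {Ω S : Type*} [MeasurableSpace Ω] [Countable S]
    (P : Measure Ω) (Y : ℕ → Ω → S) : Prop :=
  ∃ κ : S → PMF S, ∀ (n : ℕ) (s : ℕ → S) (y : S),
    P {ω | ∀ i ≤ n, Y i ω = s i} ≠ 0 →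
      P[{ω | Y (n + 1) ω = y} | {ω | ∀ i ≤ n, Y i ω = s i}] = κ (s n) y

/-! Cutting `T` at level `m` exposes a two-type branching structure. Each leaf labelled `m` of the
root component starts a positive excursion; a positive excursion `a` gives birth to one negative
excursion per vertex of label `0` in `a`, and symmetrically for negative excursions. By the
branching property, all of these are independent truncated Galton–Watson trees (`infSum_truncate`).

Attach a formal variable to every possible excursion, and let `μ`, `ν` be the masses of the two
kinds. The series `U`, `V` of the forests grown from one positive, resp. negative, excursion satisfy
`U = ∑ μ(a) X_a V^(n_a)` and `V = ∑ ν(b) X_b U^(n_b)`, and a root component with `r` leaves labelled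
`m` contributes `U^r`. Eliminating `V` gives `U = F(U)` with `F(t) = ∑ μ(a) X_a S(t)^(n_a)` and
`S(t) = ∑ ν(b) X_b t^(n_b)`. By Lagrange inversion (`lagrange_inversion`), the part of `U^r` with
`p` positive variables is `(r/p) [t^(p-r)] F(t)^p`. In `F^p` the samples `a_1, …, a_p` are
independent and meet the rest only through the power `S^(n_{a_1} + … + n_{a_p})`. So the joint
weight of the positive excursions `A` and of everything else is the mass of `A` as an unordered
independent sample, times a function of the size of `A`, its total number of zeros and the rest
(`exists_coeff_two_type`, `exists_joint_law`). As the root lies below `m`, these two numbers are the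
edge profile (`edgeProfile_eq`): given the profile the law is a product, which yields both claims.

For the Markov property, the profile at level `m + 1` is a function of the positive excursions at
level `m`, the earlier profiles are functions of the rest (`edgeProfile_succ`, `edgeProfile_of_lt`),
and neither the conditional law nor the first function depends on `m`. -/

/-! ### Infinite sums of formal power series with coefficients in `ENNReal` -/

namespace MvPowerSeries

variable {σ ι κ : Type*}

/-- The coefficientwise sum of an arbitrary family of power series over `ENNReal`. -/
noncomputable def infSum (f : ι → MvPowerSeries σ ENNReal) : MvPowerSeries σ ENNReal :=
  fun n => ∑' i, coeff n (f i)

theorem coeff_infSum (f : ι → MvPowerSeries σ ENNReal) (n : σ →₀ ℕ) :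
    coeff n (infSum f) = ∑' i, coeff n (f i) := rfl

/-- Coefficients of a product are finite sums and sums in `ENNReal` always converge, so this and the
other rearrangements of `infSum` need no summability. -/
theorem mul_infSum (g : MvPowerSeries σ ENNReal) (f : ι → MvPowerSeries σ ENNReal) :
    g * infSum f = infSum fun i => g * f i := by
  classical
  ext n
  simp only [coeff_mul, coeff_infSum, ← ENNReal.tsum_mul_left]
  exact (Summable.tsum_finsetSum fun _ _ => ENNReal.summable).symm

theorem infSum_mul (g : MvPowerSeries σ ENNReal) (f : ι → MvPowerSeries σ ENNReal) :
    infSum f * g = infSum fun i => f i * g := by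
  simp only [mul_comm _ g, mul_infSum]

theorem smul_infSum (a : ENNReal) (f : ι → MvPowerSeries σ ENNReal) :
    a • infSum f = infSum fun i => a • f i := by
  ext n
  simp only [coeff_smul, coeff_infSum, ENNReal.tsum_mul_left]

theorem infSum_comm (f : ι → κ → MvPowerSeries σ ENNReal) :
    (infSum fun i => infSum fun j => f i j) = infSum fun j => infSum fun i => f i j := by
  ext n
  simp only [coeff_infSum]
  exact ENNReal.tsum_comm

theorem infSum_prod (f : ι → κ → MvPowerSeries σ ENNReal) :
    (infSum fun p : ι × κ => f p.1 p.2) = infSum fun i => infSum fun j => f i j := by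
  ext n
  simp only [coeff_infSum]
  exact ENNReal.tsum_prod (f := fun i j => coeff n (f i j))

theorem infSum_equiv (e : ι ≃ κ) (f : κ → MvPowerSeries σ ENNReal) :
    (infSum fun i => f (e i)) = infSum f := by
  ext n
  simp only [coeff_infSum]
  exact e.tsum_eq fun j => coeff n (f j)

theorem sum_infSum (s : Finset κ) (f : κ → ι → MvPowerSeries σ ENNReal) :
    ∑ j ∈ s, infSum (f j) = infSum fun i => ∑ j ∈ s, f j i := by
  ext n
  simp only [coeff_infSum, map_sum]
  exact (Summable.tsum_finsetSum fun _ _ => ENNReal.summable).symm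

theorem infSum_ite_eq (j : κ) (f : κ → MvPowerSeries σ ENNReal) [DecidableEq κ] :
    (infSum fun i => if i = j then f i else 0) = f j := by
  ext n
  rw [coeff_infSum, tsum_eq_single j]
  · simp
  · intro i hi
    simp [hi]

theorem infSum_ite_eq' (j : κ) (f : κ → MvPowerSeries σ ENNReal) [DecidableEq κ] :
    (infSum fun i => if j = i then f i else 0) = f j := by
  simp only [eq_comm (a := j), infSum_ite_eq]

theorem infSum_fiberwise (g : ι → κ) [DecidableEq κ] (f : ι → MvPowerSeries σ ENNReal) :
    infSum f = infSum fun j => infSum fun i => if g i = j then f i else 0 := by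
  rw [infSum_comm]
  congr 1
  ext1 i
  rw [infSum_ite_eq' (g i) fun _ => f i]

theorem prod_infSum {k : ℕ} (f : Fin k → ι → MvPowerSeries σ ENNReal) :
    ∏ i, infSum (f i) = infSum fun τ : Fin k → ι => ∏ i, f i (τ i) := by
  induction k with
  | zero =>
    ext n
    rw [coeff_infSum, tsum_eq_single (fun i => i.elim0)]
    · simp
    · intro b hb
      exact absurd (Subsingleton.elim _ _) hb
  | succ k ih =>
    let e : ι × (Fin k → ι) ≃ (Fin (k + 1) → ι) := Fin.consEquiv fun _ => ι
    have he : ∀ x : ι × (Fin k → ι), ∏ i, f i (e x i) =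
        f 0 x.1 * ∏ i : Fin k, f i.succ (x.2 i) := by
      intro x
      rw [Fin.prod_univ_succ]
      rfl
    rw [Fin.prod_univ_succ, ih, ← infSum_equiv e, infSum_mul]
    simp only [mul_infSum, he]
    exact (infSum_prod fun (a : ι) (τ : Fin k → ι) => f 0 a * ∏ i : Fin k, f i.succ (τ i)).symm

/-! ### Substituting a series for the extra variable -/

/-- The composition `∑ d, (F d) * u ^ d`, where `F` is a power series in an extra variable. -/
noncomputable def substPow (u : MvPowerSeries σ ENNReal)
    (F : PowerSeries (MvPowerSeries σ ENNReal)) : MvPowerSeries σ ENNReal :=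
  infSum fun d => PowerSeries.coeff d F * u ^ d

theorem substPow_one (u : MvPowerSeries σ ENNReal) : substPow u 1 = 1 := by
  have h : (fun d => PowerSeries.coeff d (1 : PowerSeries (MvPowerSeries σ ENNReal)) * u ^ d) =
      fun d => if d = 0 then 1 else 0 := by
    ext1 d
    rw [PowerSeries.coeff_one]
    split_ifs with h <;> simp [h]
  rw [substPow, h, infSum_ite_eq 0 fun _ => 1]

/-- Pairs of exponents are regrouped by their sum. Nothing is asked of the constant term of `u`,
since all sums exist in `ENNReal`. -/
theorem substPow_mul (u : MvPowerSeries σ ENNReal)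
    (F G : PowerSeries (MvPowerSeries σ ENNReal)) :
    substPow u (F * G) = substPow u F * substPow u G := by
  have h : substPow u F * substPow u G =
      infSum fun p : ℕ × ℕ => PowerSeries.coeff p.1 F * PowerSeries.coeff p.2 G * u ^ (p.1 + p.2) := by
    rw [substPow, substPow, infSum_mul]
    simp only [mul_infSum]
    rw [← infSum_prod]
    congr 1
    ext1 p
    ring
  rw [h, ← infSum_equiv Finset.HasAntidiagonal.sigmaAntidiagonalEquivProd]
  ext n
  simp only [substPow, coeff_infSum]
  rw [ENNReal.tsum_sigma']
  refine tsum_congr fun d => ?_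
  rw [PowerSeries.coeff_mul, Finset.sum_mul, map_sum, tsum_fintype,
    ← Finset.sum_coe_sort (Finset.HasAntidiagonal.antidiagonal d)]
  refine Finset.sum_congr rfl fun p _ => ?_
  have := Finset.HasAntidiagonal.mem_antidiagonal.1 p.2
  simp [Finset.HasAntidiagonal.sigmaAntidiagonalEquivProd, this]

theorem substPow_pow (u : MvPowerSeries σ ENNReal)
    (F : PowerSeries (MvPowerSeries σ ENNReal)) (k : ℕ) :
    substPow u (F ^ k) = substPow u F ^ k := by
  induction k with
  | zero => simp [substPow_one]
  | succ k ih => rw [pow_succ, substPow_mul, ih, pow_succ]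

/-! ### Lagrange inversion -/

section Lagrange

/-- Agreement of the homogeneous parts of degree `p`. -/
def DegEq (w : (σ →₀ ℕ) →+ ℕ) (p : ℕ) (f g : MvPowerSeries σ ENNReal) : Prop :=
  ∀ n, w n = p → coeff n f = coeff n g

/-- Since `h` is concentrated in degree one, only the part of degree `p` of the other factor reaches
degree `p + 1`. -/
theorem DegEq.mul_left {w : (σ →₀ ℕ) →+ ℕ} {p : ℕ} {f g h : MvPowerSeries σ ENNReal}
    (hfg : DegEq w p f g) (hh : ∀ n, w n ≠ 1 → coeff n h = 0) :
    DegEq w (p + 1) (h * f) (h * g) := by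
  classical
  intro n hn
  rw [coeff_mul, coeff_mul]
  refine Finset.sum_congr rfl fun x hx => ?_
  by_cases h1 : w x.1 = 1
  · have hx := Finset.HasAntidiagonal.mem_antidiagonal.1 hx
    rw [← hx, map_add, h1] at hn
    rw [hfg x.2 (by omega)]
  · rw [hh _ h1, zero_mul, zero_mul]

theorem DegEq.infSum {w : (σ →₀ ℕ) →+ ℕ} {p : ℕ} {f g : ι → MvPowerSeries σ ENNReal}
    (hfg : ∀ i, DegEq w p (f i) (g i)) : DegEq w p (infSum f) (infSum g) := by
  intro n hn
  rw [coeff_infSum, coeff_infSum]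
  exact tsum_congr fun i => hfg i n hn

/-- Both sides are coefficients of `X * (F ^ (p + 1))'`, the left one after differentiating the
power. -/
theorem coeff_weighted_mul_pow {R : Type*} [CommSemiring R] (F : PowerSeries R) (p j : ℕ) :
    ((p + 1 : ℕ) : R) * ∑ x ∈ Finset.HasAntidiagonal.antidiagonal j,
        (x.1 : R) * PowerSeries.coeff x.1 F * PowerSeries.coeff x.2 (F ^ p) =
      (j : R) * PowerSeries.coeff j (F ^ (p + 1)) := by
  have hD : ∀ (G : PowerSeries R) (i : ℕ),
      PowerSeries.coeff i (PowerSeries.X * PowerSeries.derivative R G) =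
        (i : R) * PowerSeries.coeff i G := by
    intro G i
    cases i with
    | zero => simp
    | succ i =>
      rw [PowerSeries.coeff_succ_X_mul, PowerSeries.coeff_derivative]
      push_cast
      ring
  rw [← hD, Derivation.leibniz_pow]
  simp only [Nat.add_sub_cancel, smul_eq_mul, nsmul_eq_mul]
  have h2 : (PowerSeries.X : PowerSeries R) * (((p + 1 : ℕ) : PowerSeries R) *
      (F ^ p * PowerSeries.derivative R F)) =
      PowerSeries.C ((p + 1 : ℕ) : R) *
        ((PowerSeries.X * PowerSeries.derivative R F) * F ^ p) := by
    rw [map_natCast]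
    ring
  rw [h2, PowerSeries.coeff_C_mul, PowerSeries.coeff_mul]
  simp only [hD]

/-- A form of Lagrange inversion: if `u = F(u)` and the coefficients of `F` are homogeneous of
degree one, then the part of degree `p` of `u ^ r` is `r / p` times the coefficient of order `p - r`
of `F ^ p`. -/
theorem lagrange_inversion (w : (σ →₀ ℕ) →+ ℕ) (u : MvPowerSeries σ ENNReal)
    (F : PowerSeries (MvPowerSeries σ ENNReal)) (hu : u = substPow u F)
    (hF : ∀ d n, w n ≠ 1 → coeff n (PowerSeries.coeff d F) = 0) (p r : ℕ) :
    DegEq w p ((p : MvPowerSeries σ ENNReal) * u ^ r)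
      ((r : MvPowerSeries σ ENNReal) * PowerSeries.coeff p (PowerSeries.X ^ r * F ^ p)) := by
  classical
  have hstep : ∀ r, u ^ (r + 1) = infSum fun d => PowerSeries.coeff d F * u ^ (r + d) := by
    intro r
    have h : u ^ (r + 1) = u ^ r * substPow u F := by rw [← hu, pow_succ]
    rw [h, substPow, mul_infSum]
    congr 1
    ext1 d
    ring
  -- Every term of `hstep` carries a coefficient of `F`, of degree one. This takes the place of a
  -- smallness assumption on `u`.
  have hzero : ∀ r, DegEq w 0 (u ^ (r + 1)) 0 := by
    intro r n hn
    rw [hstep, coeff_infSum, coeff_zero, ENNReal.tsum_eq_zero]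
    intro d
    rw [coeff_mul]
    refine Finset.sum_eq_zero fun x hx => ?_
    have hx := Finset.HasAntidiagonal.mem_antidiagonal.1 hx
    rw [← hx, map_add] at hn
    rw [hF _ _ (by omega), zero_mul]
  -- By `hstep`, the part of degree `p + 1` of `u ^ (r + 1)` is determined by the parts of degree
  -- `p` of all the powers `u ^ (r + d)`.
  induction p generalizing r with
  | zero =>
    intro n hn
    rcases Nat.eq_zero_or_pos r with rfl | hr
    · simp
    · simp [hr.ne]
  | succ p ih =>
    intro n hn
    rcases r with _ | r
    · have : n ≠ 0 := by
        rintro rfl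
        simp at hn
      rw [pow_zero, mul_one, Nat.cast_zero, zero_mul, coeff_zero, ← map_natCast C, coeff_C,
        if_neg this]
    -- The induction hypothesis in degree `0` is multiplied by `0` and says nothing about `u`, so
    -- degree one is computed from `hzero`.
    rcases p with _ | p
    · rw [hstep]
      have h1 : ∀ d, DegEq w 1 (PowerSeries.coeff d F * u ^ (r + d))
          (if d = 0 then (if r = 0 then PowerSeries.coeff 0 F else 0) else 0) := by
        intro d
        by_cases hd : r + d = 0
        · have h : r = 0 := by omega
          have h' : d = 0 := by omega
          subst h h'
          intro n hn
          simp
        · have h0 := (hzero (r + d - 1)).mul_left (hF d)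
          rw [Nat.sub_add_cancel (by omega)] at h0
          intro n hn
          rw [h0 n hn]
          by_cases h2 : d = 0
          · simp [h2, show r ≠ 0 by omega]
          · simp [h2]
      have h2 := DegEq.infSum h1 n hn
      rw [infSum_ite_eq 0 fun _ => (if r = 0 then PowerSeries.coeff 0 F else 0)] at h2
      simp only [zero_add, Nat.cast_one, one_mul, pow_one, h2]
      by_cases hr : r = 0
      · simp [hr, PowerSeries.coeff_succ_X_mul]
      · simp [hr, PowerSeries.coeff_X_pow_mul']
    · set P := p + 1 with hP
      have h1 : DegEq w (P + 1) ((P : MvPowerSeries σ ENNReal) * u ^ (r + 1))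
          (infSum fun d => PowerSeries.coeff d F * (((r + d : ℕ) : MvPowerSeries σ ENNReal) *
            PowerSeries.coeff P (PowerSeries.X ^ (r + d) * F ^ P))) := by
        rw [hstep, mul_infSum]
        refine DegEq.infSum fun d => ?_
        rw [mul_left_comm]
        exact (ih (r + d)).mul_left (hF d)
      -- With `j = P - r`, the weight `r + d` splits into `r`, giving a plain convolution, and `d`,
      -- handled by `coeff_weighted_mul_pow`. The constants add up to `(P + 1) * r + j = P * (r +
      -- 1)`.
      have h2 : ((P + 1 : ℕ) : MvPowerSeries σ ENNReal) *
          (infSum fun d => PowerSeries.coeff d F * (((r + d : ℕ) : MvPowerSeries σ ENNReal) *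
            PowerSeries.coeff P (PowerSeries.X ^ (r + d) * F ^ P))) =
          ((P * (r + 1) : ℕ) : MvPowerSeries σ ENNReal) *
            PowerSeries.coeff (P + 1) (PowerSeries.X ^ (r + 1) * F ^ (P + 1)) := by
        rw [PowerSeries.coeff_X_pow_mul']
        split_ifs with hrp
        · obtain ⟨j, hj⟩ := Nat.exists_eq_add_of_le hrp
          have hPj : P = r + j := by omega
          have h3 : (infSum fun d => PowerSeries.coeff d F *
              (((r + d : ℕ) : MvPowerSeries σ ENNReal) *
              PowerSeries.coeff P (PowerSeries.X ^ (r + d) * F ^ P))) =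
              ∑ x ∈ Finset.HasAntidiagonal.antidiagonal j,
                PowerSeries.coeff x.1 F * (((r + x.1 : ℕ) : MvPowerSeries σ ENNReal) *
                PowerSeries.coeff x.2 (F ^ P)) := by
            rw [Finset.Nat.sum_antidiagonal_eq_sum_range_succ (fun a b => PowerSeries.coeff a F *
              (((r + a : ℕ) : MvPowerSeries σ ENNReal) * PowerSeries.coeff b (F ^ P)))]
            ext n
            rw [coeff_infSum, map_sum, tsum_eq_sum (s := Finset.range (j + 1))]
            · refine Finset.sum_congr rfl fun d hd => ?_
              have := Finset.mem_range.1 hd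
              rw [PowerSeries.coeff_X_pow_mul', if_pos (by omega)]
              congr 5
              omega
            · intro d hd
              have := Finset.mem_range.not.1 hd
              rw [PowerSeries.coeff_X_pow_mul', if_neg (by omega)]
              simp
          have h4 := coeff_weighted_mul_pow F P j
          have h5 : PowerSeries.coeff j (F ^ (P + 1)) =
              ∑ x ∈ Finset.HasAntidiagonal.antidiagonal j,
                PowerSeries.coeff x.1 F * PowerSeries.coeff x.2 (F ^ P) := by
            rw [pow_succ', PowerSeries.coeff_mul]
          rw [h3, show P + 1 - (r + 1) = j by omega]
          have h6 : ∑ x ∈ Finset.HasAntidiagonal.antidiagonal j,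
                PowerSeries.coeff x.1 F * (((r + x.1 : ℕ) : MvPowerSeries σ ENNReal) *
                PowerSeries.coeff x.2 (F ^ P)) =
              (r : MvPowerSeries σ ENNReal) * PowerSeries.coeff j (F ^ (P + 1)) +
              ∑ x ∈ Finset.HasAntidiagonal.antidiagonal j,
                (x.1 : MvPowerSeries σ ENNReal) * PowerSeries.coeff x.1 F *
                  PowerSeries.coeff x.2 (F ^ P) := by
            rw [h5, Finset.mul_sum, ← Finset.sum_add_distrib]
            refine Finset.sum_congr rfl fun x _ => ?_
            push_cast
            ring
          rw [h6, mul_add, h4, ← mul_assoc, ← add_mul, ← Nat.cast_mul, ← Nat.cast_add]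
          congr 2
          rw [hPj]
          ring
        · rw [mul_zero]
          convert mul_zero _
          ext n
          rw [coeff_infSum, coeff_zero, ENNReal.tsum_eq_zero]
          intro d
          rw [PowerSeries.coeff_X_pow_mul', if_neg (by omega)]
          simp
      have hcast : ∀ (k : ℕ) (f : MvPowerSeries σ ENNReal) (n : σ →₀ ℕ),
          coeff n ((k : MvPowerSeries σ ENNReal) * f) = k * coeff n f := by
        intro k f n
        rw [← map_natCast C, coeff_C_mul]
      have h7 := h1 n hn
      have h8 := congrArg (coeff n) h2
      rw [hcast] at h7
      rw [hcast, hcast, ← h7] at h8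
      rw [hcast, hcast]
      have hP0 : (P : ENNReal) ≠ 0 := by simp [hP]
      refine (ENNReal.mul_right_inj hP0 (ENNReal.natCast_ne_top P)).1 ?_
      rw [mul_left_comm, h8]
      push_cast
      ring

end Lagrange

end MvPowerSeries

/-! ### Independent samples, up to order -/

section MultisetMass

variable {α : Type*}

/-- The mass of the multiset `A` under the law of `{τ 1, …, τ p}`, where `τ 1, …, τ p` are
independent and have mass function `μ`. -/
noncomputable def multisetMass (μ : α → ENNReal) (p : ℕ) (A : Multiset α) : ENNReal :=
  open Classical in
  ∑' τ : Fin p → α, if Finset.univ.val.map τ = A then ∏ i, μ (τ i) else 0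

theorem map_univ_cons {p : ℕ} (a : α) (τ : Fin p → α) :
    (Finset.univ : Finset (Fin (p + 1))).val.map (Fin.cons a τ : Fin (p + 1) → α) =
      a ::ₘ Finset.univ.val.map τ := by
  rw [Fin.univ_succ, Finset.cons_val, Multiset.map_cons, Finset.map_val, Multiset.map_map]
  simp

theorem multisetMass_zero (μ : α → ENNReal) : multisetMass μ 0 0 = 1 := by
  rw [multisetMass, tsum_eq_single (fun i => i.elim0)]
  · simp
  · intro b hb
    exact absurd (Subsingleton.elim _ _) hb

/-- Sums over the value `a` of the first ordered sample. The extraction of a variable in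
`coeff_mark_X_mul` obeys the same recursion. -/
theorem multisetMass_succ [DecidableEq α] (μ : α → ENNReal) (p : ℕ) (A : Multiset α) :
    multisetMass μ (p + 1) A =
      ∑' a, μ a * if a ∈ A then multisetMass μ p (A.erase a) else 0 := by
  let e : α × (Fin p → α) ≃ (Fin (p + 1) → α) := Fin.consEquiv fun _ => α
  rw [multisetMass, ← e.tsum_eq, ENNReal.tsum_prod']
  refine tsum_congr fun a => ?_
  have h : ∀ τ : Fin p → α, Finset.univ.val.map (e (a, τ)) = a ::ₘ Finset.univ.val.map τ :=
    fun τ => map_univ_cons a τ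
  have h' : ∀ τ : Fin p → α, ∏ i, μ (e (a, τ) i) = μ a * ∏ i, μ (τ i) := by
    intro τ
    rw [Fin.prod_univ_succ]
    rfl
  simp only [h, h']
  split_ifs with ha
  · rw [multisetMass, ← ENNReal.tsum_mul_left]
    refine tsum_congr fun τ => ?_
    have : a ::ₘ Finset.univ.val.map τ = A ↔ Finset.univ.val.map τ = A.erase a := by
      constructor
      · rintro rfl
        simp
      · intro h
        rw [h, Multiset.cons_erase ha]
    simp only [this, mul_ite, mul_zero]
  · rw [mul_zero, ENNReal.tsum_eq_zero]
    intro τ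
    rw [if_neg]
    rintro rfl
    simp at ha

end MultisetMass

/-! ### Two-type branching equations -/

namespace MvPowerSeries

variable {α β : Type*}

/-- The exponent of the monomial attached to a pair of multisets. -/
noncomputable def mark (A : Multiset α) (B : Multiset β) : α ⊕ β →₀ ℕ :=
  open Classical in Multiset.toFinsupp (A.map Sum.inl + B.map Sum.inr)

theorem mark_add (A A' : Multiset α) (B B' : Multiset β) :
    mark (A + A') (B + B') = mark A B + mark A' B' := by
  classical
  rw [mark, mark, mark, ← map_add]
  congr 1
  simp only [Multiset.map_add]
  abel

theorem mark_zero : mark (0 : Multiset α) (0 : Multiset β) = 0 := by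
  simp [mark]

theorem mark_singleton_left (a : α) : mark {a} (0 : Multiset β) = Finsupp.single (Sum.inl a) 1 := by
  classical
  simp [mark]

theorem mark_singleton_right (b : β) : mark (0 : Multiset α) {b} = Finsupp.single (Sum.inr b) 1 := by
  classical
  simp [mark]

/-- Makes the coefficient at `mark A B` isolate the forests whose vertices are exactly `A` and `B`.
-/
theorem mark_inj {A A' : Multiset α} {B B' : Multiset β} :
    mark A B = mark A' B' ↔ A = A' ∧ B = B' := by
  classical
  refine ⟨fun h => ?_, fun h => by rw [h.1, h.2]⟩
  have h := Multiset.toFinsupp.injective h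
  have hl := congrArg (Multiset.filterMap fun x : α ⊕ β => x.elim some fun _ => none) h
  have hr := congrArg (Multiset.filterMap fun x : α ⊕ β => x.elim (fun _ => none) some) h
  have h1 : ∀ A : Multiset α, A.filterMap (fun _ => (none : Option β)) = 0 :=
    fun A => Multiset.induction_on A (by simp) (by simp)
  have h2 : ∀ B : Multiset β, B.filterMap (fun _ => (none : Option α)) = 0 :=
    fun B => Multiset.induction_on B (by simp) (by simp)
  simp only [Multiset.filterMap_add, Multiset.filterMap_map, Sum.elim_inl, Sum.elim_inr,
    Function.comp_def, Multiset.filterMap_some, h1, h2, add_zero, zero_add] at hl hr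
  exact ⟨hl, hr⟩

/-- The degree in the variables of the first kind. -/
noncomputable def leftDegree : (α ⊕ β →₀ ℕ) →+ ℕ :=
  Finsupp.weight (Sum.elim (fun _ => 1) fun _ => 0)

theorem leftDegree_inl (a : α) : leftDegree (Finsupp.single (Sum.inl a : α ⊕ β) 1) = 1 := by
  simp [leftDegree, Finsupp.weight_single]

theorem leftDegree_inr (b : β) : leftDegree (Finsupp.single (Sum.inr b : α ⊕ β) 1) = 0 := by
  simp [leftDegree, Finsupp.weight_single]

theorem leftDegree_mark (A : Multiset α) (B : Multiset β) : leftDegree (mark A B) = A.card := by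
  induction A using Multiset.induction_on with
  | empty =>
    induction B using Multiset.induction_on with
    | empty => simp [mark_zero]
    | cons b B ih =>
      rw [← Multiset.singleton_add, ← zero_add (0 : Multiset α), mark_add, map_add, ih,
        mark_singleton_right, leftDegree_inr]
      simp
  | cons a A ih =>
    rw [← Multiset.singleton_add, ← zero_add B, mark_add, map_add, ih,
      mark_singleton_left, leftDegree_inl, Multiset.singleton_add, Multiset.card_cons, add_comm]

theorem mark_inl_of_notMem {a : α} {A : Multiset α} (ha : a ∉ A) (B : Multiset β) :
    mark A B (Sum.inl a) = 0 := by
  classical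
  simp [mark, ha]

theorem coeff_mark_X_mul [DecidableEq α] (a : α) (A : Multiset α) (B : Multiset β)
    (f : MvPowerSeries (α ⊕ β) ENNReal) :
    coeff (mark A B) (X (Sum.inl a) * f) = if a ∈ A then coeff (mark (A.erase a) B) f else 0 := by
  rw [X, coeff_monomial_mul, one_mul]
  by_cases ha : a ∈ A
  · obtain ⟨A', rfl⟩ := Multiset.exists_cons_of_mem ha
    have : mark (a ::ₘ A') B = Finsupp.single (Sum.inl a) 1 + mark A' B := by
      rw [← mark_singleton_left, ← mark_add, zero_add, Multiset.singleton_add]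
    rw [this, if_pos ha, if_pos le_self_add, add_tsub_cancel_left, Multiset.erase_cons_head]
  · rw [if_neg ha, if_neg]
    intro hle
    have h := hle (Sum.inl a)
    rw [Finsupp.single_eq_same, mark_inl_of_notMem ha] at h
    simp at h

theorem coeff_X_mul_eq_zero {σ : Type*} (w : (σ →₀ ℕ) →+ ℕ) (s : σ)
    (f : MvPowerSeries σ ENNReal) (p : ℕ) (hf : ∀ n, w n ≠ p → coeff n f = 0) (n : σ →₀ ℕ)
    (hn : w n ≠ w (Finsupp.single s 1) + p) : coeff n (X s * f) = 0 := by
  rw [X, coeff_monomial_mul, one_mul]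
  split_ifs with h
  · refine hf _ fun h' => hn ?_
    rw [← h', ← map_add, add_tsub_cancel_of_le h]
  · rfl

theorem coeff_pow_eq_zero {σ : Type*} (w : (σ →₀ ℕ) →+ ℕ)
    (F : PowerSeries (MvPowerSeries σ ENNReal))
    (hF : ∀ d n, w n ≠ 0 → coeff n (PowerSeries.coeff d F) = 0) (e d : ℕ) (n : σ →₀ ℕ)
    (hn : w n ≠ 0) : coeff n (PowerSeries.coeff d (F ^ e)) = 0 := by
  classical
  induction e generalizing d n with
  | zero =>
    have : n ≠ 0 := by
      rintro rfl
      simp at hn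
    rw [pow_zero, PowerSeries.coeff_one]
    split_ifs
    · rw [coeff_one, if_neg this]
    · simp
  | succ e ih =>
    rw [pow_succ, PowerSeries.coeff_mul, map_sum]
    refine Finset.sum_eq_zero fun x _ => ?_
    rw [coeff_mul]
    refine Finset.sum_eq_zero fun y hy => ?_
    have hy := Finset.HasAntidiagonal.mem_antidiagonal.1 hy
    rw [← hy, map_add] at hn
    by_cases h : w y.1 = 0
    · rw [hF _ y.2 (by omega), mul_zero]
    · rw [ih _ _ h, zero_mul]

section TwoType

variable (μ : α → ENNReal) (ν : β → ENNReal) (c : α → ℕ) (d : β → ℕ)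

/-- The generating series of a vertex of the second kind, with its number of children. -/
noncomputable def secondKind : PowerSeries (MvPowerSeries (α ⊕ β) ENNReal) :=
  PowerSeries.mk fun k => infSum fun b => if d b = k then ν b • X (Sum.inr b) else 0

/-- The generating series of a vertex of the first kind with its children, all of the second kind,
and their number of children. -/
noncomputable def firstKind : PowerSeries (MvPowerSeries (α ⊕ β) ENNReal) :=
  PowerSeries.mk fun k => infSum fun a =>
    μ a • (X (Sum.inl a) * PowerSeries.coeff k (secondKind ν d ^ c a))

theorem coeff_secondKind_pow (e k : ℕ) (n : α ⊕ β →₀ ℕ) (hn : leftDegree n ≠ 0) :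
    coeff n (PowerSeries.coeff k (secondKind (α := α) ν d ^ e)) = 0 := by
  classical
  refine coeff_pow_eq_zero leftDegree _ (fun k n hn => ?_) e k n hn
  rw [secondKind, PowerSeries.coeff_mk, coeff_infSum, ENNReal.tsum_eq_zero]
  intro b
  split_ifs
  · rw [coeff_smul, coeff_X, if_neg, mul_zero]
    rintro rfl
    exact hn (leftDegree_inr b)
  · simp

theorem coeff_firstKind (k : ℕ) (n : α ⊕ β →₀ ℕ) (hn : leftDegree n ≠ 1) :
    coeff n (PowerSeries.coeff k (firstKind μ ν c d)) = 0 := by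
  rw [firstKind, PowerSeries.coeff_mk, coeff_infSum, ENNReal.tsum_eq_zero]
  intro a
  rw [coeff_smul, coeff_X_mul_eq_zero leftDegree _ _ 0 (coeff_secondKind_pow ν d _ _) _
    (by rwa [leftDegree_inl]), mul_zero]

theorem coeff_firstKind_mul (k : ℕ) (G : PowerSeries (MvPowerSeries (α ⊕ β) ENNReal)) :
    PowerSeries.coeff k (firstKind μ ν c d * G) = infSum fun a =>
      μ a • (X (Sum.inl a) * PowerSeries.coeff k (secondKind ν d ^ c a * G)) := by
  simp only [PowerSeries.coeff_mul, firstKind, PowerSeries.coeff_mk, infSum_mul]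
  rw [sum_infSum]
  congr 1
  ext1 a
  rw [Finset.mul_sum, Finset.smul_sum]
  refine Finset.sum_congr rfl fun x _ => ?_
  rw [smul_mul_assoc, mul_assoc]

/-- Each factor `firstKind` supplies one variable `a` of the first kind with weight `μ a` and
releases `c a` factors `secondKind`, which contain no such variable. Peeling the factors off one by
one enumerates the ordered samples of `A`; `e` accumulates the factors already released. -/
theorem coeff_firstKind_pow (p e j : ℕ) (A : Multiset α) (hA : A.card = p) (B : Multiset β) :
    coeff (mark A B) (PowerSeries.coeff j (firstKind μ ν c d ^ p * secondKind ν d ^ e)) =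
      multisetMass μ p A *
        coeff (mark 0 B) (PowerSeries.coeff j (secondKind (α := α) ν d ^ ((A.map c).sum + e))) := by
  classical
  induction p generalizing A e with
  | zero =>
    rw [Multiset.card_eq_zero] at hA
    subst hA
    simp [multisetMass_zero]
  | succ p ih =>
    rw [pow_succ', mul_assoc, coeff_firstKind_mul, coeff_infSum, multisetMass_succ,
      ← ENNReal.tsum_mul_right]
    refine tsum_congr fun a => ?_
    rw [coeff_smul, coeff_mark_X_mul, mul_assoc, mul_left_comm (_ ^ c a), ← pow_add]
    split_ifs with ha
    · obtain ⟨A', rfl⟩ := Multiset.exists_cons_of_mem ha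
      rw [Multiset.card_cons, add_left_inj] at hA
      rw [Multiset.erase_cons_head, ih _ _ hA, Multiset.map_cons, Multiset.sum_cons,
        add_left_comm, add_assoc]
    · simp

variable {μ ν c d} {U V : MvPowerSeries (α ⊕ β) ENNReal}

theorem substPow_secondKind (hV : V = infSum fun b => ν b • (X (Sum.inr b) * U ^ d b)) :
    substPow U (secondKind ν d) = V := by
  rw [hV, substPow]
  simp only [secondKind, PowerSeries.coeff_mk, infSum_mul]
  rw [infSum_comm]
  congr 1
  ext1 b
  have : ∀ k, (if d b = k then ν b • X (Sum.inr b) else 0) * U ^ k =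
      if d b = k then ν b • (X (Sum.inr b) * U ^ k) else 0 := by
    intro k
    split_ifs
    · rw [smul_mul_assoc]
    · rw [zero_mul]
  simp only [this]
  rw [infSum_ite_eq' (d b) fun k => ν b • (X (Sum.inr b) * U ^ k)]

/-- Eliminating `V` leaves one fixed-point equation for `U`, as Lagrange inversion requires. -/
theorem substPow_firstKind (hU : U = infSum fun a => μ a • (X (Sum.inl a) * V ^ c a))
    (hV : V = infSum fun b => ν b • (X (Sum.inr b) * U ^ d b)) :
    substPow U (firstKind μ ν c d) = U := by
  conv_rhs => rw [hU]
  rw [substPow]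
  simp only [firstKind, PowerSeries.coeff_mk, infSum_mul]
  rw [infSum_comm]
  congr 1
  ext1 a
  rw [← substPow_secondKind hV, ← substPow_pow, substPow, mul_infSum, smul_infSum]
  congr 1
  ext1 k
  rw [smul_mul_assoc, mul_assoc]

/-- In a two-type branching forest grown from `r` vertices of the first kind, the weight of the
forests with given multisets of vertices `A` and `B` of the two kinds depends on `A` only through the
weight of the unordered samples `A`, the size of `A` and the total number of children of `A`. -/
theorem exists_coeff_two_type (hU : U = infSum fun a => μ a • (X (Sum.inl a) * V ^ c a))
    (hV : V = infSum fun b => ν b • (X (Sum.inr b) * U ^ d b)) :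
    ∃ H : ℕ → ℕ → ℕ → Multiset β → ENNReal, ∀ (r : ℕ) (A : Multiset α) (B : Multiset β),
      coeff (mark A B) (U ^ r) = multisetMass μ A.card A * H r A.card (A.map c).sum B := by
  classical
  -- The factor `r / p` and the power of `secondKind` come from Lagrange inversion. For `p = 0` that
  -- formula degenerates, and only the empty forest has no vertex of the first kind.
  refine ⟨fun r p q B => if p = 0 then (if r = 0 ∧ B = 0 then 1 else 0) else
    (p : ENNReal)⁻¹ * (r * coeff (mark 0 B)
      (PowerSeries.coeff p (PowerSeries.X ^ r * secondKind (α := α) ν d ^ q))), fun r A B => ?_⟩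
  dsimp only
  split_ifs with hA hr
  · obtain rfl := Multiset.card_eq_zero.1 hA
    simp [hr.1, hr.2, multisetMass_zero, mark_zero]
  · obtain rfl := Multiset.card_eq_zero.1 hA
    rw [mul_zero]
    rcases r with _ | r
    · have hB : B ≠ 0 := fun h => hr ⟨rfl, h⟩
      rw [pow_zero, coeff_one, if_neg]
      rw [← mark_zero, mark_inj]
      simp [hB]
    · rw [pow_succ', hU, infSum_mul, coeff_infSum, ENNReal.tsum_eq_zero]
      intro a
      rw [smul_mul_assoc, mul_assoc, coeff_smul, coeff_mark_X_mul]
      simp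
  · have h := lagrange_inversion leftDegree U (firstKind μ ν c d) (substPow_firstKind hU hV).symm
      (coeff_firstKind μ ν c d) A.card r (mark A B) (leftDegree_mark A B)
    have hcast : ∀ (k : ℕ) (f : MvPowerSeries (α ⊕ β) ENNReal) (n : α ⊕ β →₀ ℕ),
        coeff n ((k : MvPowerSeries (α ⊕ β) ENNReal) * f) = k * coeff n f := by
      intro k f n
      rw [← map_natCast C, coeff_C_mul]
    rw [hcast, hcast] at h
    have hA' : (A.card : ENNReal) ≠ 0 := by exact_mod_cast hA
    have h' : coeff (mark A B) (U ^ r) =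
        (A.card : ENNReal)⁻¹ * (A.card * coeff (mark A B) (U ^ r)) := by
      rw [← mul_assoc, ENNReal.inv_mul_cancel hA' (ENNReal.natCast_ne_top _), one_mul]
    rw [h', h, mul_left_comm (multisetMass _ _ _), mul_left_comm (multisetMass _ _ _)]
    congr 2
    simp only [PowerSeries.coeff_X_pow_mul']
    split_ifs
    · have := coeff_firstKind_pow μ ν c d A.card 0 (A.card - r) A rfl B
      rwa [pow_zero, mul_one, add_zero] at this
    · simp

end TwoType

end MvPowerSeries

/-! ### Cutting labelled trees -/

namespace LabelledTree

theorem multiset_sum_map_sum {ι α M : Type*} [AddCommMonoid M] (s : Finset ι)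
    (f : ι → Multiset α) (g : α → M) :
    ((∑ i ∈ s, f i).map g).sum = ∑ i ∈ s, ((f i).map g).sum :=
  map_sum ((Multiset.sumAddMonoidHom (M := M)).comp (Multiset.mapAddMonoidHom g)) f s

theorem rootLabel_truncate (l : ℤ) (t : LabelledTree) : (truncate l t).rootLabel = t.rootLabel := by
  cases t with
  | node x k c =>
    rw [truncate]
    split_ifs <;> rfl

theorem rootLabel_component (m : ℤ) (t : LabelledTree) :
    (component m t).rootLabel = t.rootLabel := by
  cases t
  rfl

theorem truncate_of_rootLabel_eq {l : ℤ} {t : LabelledTree} (h : t.rootLabel = l) :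
    truncate l t = leaf l := by
  cases t with
  | node x k c =>
    change x = l at h
    rw [truncate, if_pos h, h]

theorem rootLabel_child {x : ℤ} {k : ℕ} {c : Fin k → LabelledTree}
    (h : (node x k c).HasUnitIncrements) (i : Fin k) :
    x - 1 ≤ (c i).rootLabel ∧ (c i).rootLabel ≤ x + 1 := by
  have := (h i).1
  simp only [Set.mem_insert_iff, Set.mem_singleton_iff] at this
  omega

/-- Labels move by at most one, so a path starting below `m` first reaches `m` through a cut edge
from `m - 1`. -/
theorem component_eq_truncate_of_lt {m : ℤ} {t : LabelledTree} (ht : t.HasUnitIncrements)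
    (hm : t.rootLabel < m) : component m t = truncate m t := by
  induction t with
  | node x k c ih =>
    change x < m at hm
    rw [component, truncate, if_neg (by omega)]
    congr 1
    ext1 i
    have hc := rootLabel_child ht i
    split_ifs with h
    · have h' : (c i).rootLabel = m := by omega
      rw [truncate_of_rootLabel_eq h', h']
    · exact ih i (ht i).2 (by omega)

theorem component_eq_truncate_of_le {m : ℤ} {t : LabelledTree} (ht : t.HasUnitIncrements)
    (hm : m ≤ t.rootLabel) : component m t = truncate (m - 1) t := by
  induction t with
  | node x k c ih =>
    change m ≤ x at hm
    rw [component, truncate, if_neg (by omega)]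
    congr 1
    ext1 i
    have hc := rootLabel_child ht i
    split_ifs with h
    · have h' : (c i).rootLabel = m - 1 := by omega
      rw [truncate_of_rootLabel_eq h', h']
    · exact ih i (ht i).2 (by omega)

/-! #### Shifts -/

theorem rootLabel_shift (s : ℤ) (t : LabelledTree) :
    (shift s t).rootLabel = t.rootLabel + s := by
  cases t
  rfl

theorem shift_shift (s r : ℤ) (t : LabelledTree) : shift s (shift r t) = shift (r + s) t := by
  induction t with
  | node x k c ih => simp only [shift, ih, add_assoc]

theorem shift_zero (t : LabelledTree) : shift 0 t = t := by
  induction t with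
  | node x k c ih => simp only [shift, ih, add_zero]

/-- Shifting all labels is a bijection. -/
def shiftEquiv (s : ℤ) : LabelledTree ≃ LabelledTree where
  toFun := shift s
  invFun := shift (-s)
  left_inv t := by rw [shift_shift, add_neg_cancel, shift_zero]
  right_inv t := by rw [shift_shift, neg_add_cancel, shift_zero]

theorem truncate_shift (l s : ℤ) (t : LabelledTree) :
    truncate (l + s) (shift s t) = shift s (truncate l t) := by
  induction t with
  | node x k c ih =>
    rw [shift, truncate, truncate]
    by_cases h : x = l
    · rw [if_pos h, if_pos (by omega)]
      simp only [leaf, shift]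
      congr 1
      ext1 i
      exact i.elim0
    · rw [if_neg h, if_neg (by omega)]
      simp only [shift, ih]

theorem labelCount_shift (a s : ℤ) (t : LabelledTree) :
    labelCount (a + s) (shift s t) = labelCount a t := by
  induction t with
  | node x k c ih => simp only [shift, labelCount, ih, add_left_inj]

theorem edgeCount_shift (a b s : ℤ) (t : LabelledTree) :
    edgeCount (a + s) (b + s) (shift s t) = edgeCount a b t := by
  induction t with
  | node x k c ih => simp only [shift, edgeCount, ih, rootLabel_shift, add_left_inj]

theorem edgeCount_shift_neg (a b s : ℤ) (t : LabelledTree) :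
    edgeCount (a - s) (b - s) (shift (-s) t) = edgeCount a b t :=
  edgeCount_shift a b (-s) t

theorem edgeCount_leaf (a b x : ℤ) : edgeCount a b (leaf x) = 0 := by
  simp [leaf, edgeCount]

theorem weight_shift (ξ : PMF ℕ) (η : (k : ℕ) → PMF (Fin k → ℤ)) (s : ℤ) (t : LabelledTree) :
    weight ξ η (shift s t) = weight ξ η t := by
  induction t with
  | node x k c ih => simp only [shift, weight, ih, rootLabel_shift, add_sub_add_right_eq_sub]

/-! #### Counting edges in excursions -/

theorem card_positiveExcursions (m : ℤ) (t : LabelledTree) :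
    (positiveExcursions m t).card = edgeCount (m - 1) m t := by
  induction t with
  | node x k c ih =>
    rw [positiveExcursions, edgeCount, Multiset.card_sum]
    refine Finset.sum_congr rfl fun i _ => ?_
    rw [Multiset.card_add, ih]
    split_ifs <;> simp

theorem card_negativeExcursions (m : ℤ) (t : LabelledTree) :
    (negativeExcursions m t).card = edgeCount m (m - 1) t := by
  induction t with
  | node x k c ih =>
    rw [negativeExcursions, edgeCount, Multiset.card_sum]
    refine Finset.sum_congr rfl fun i _ => ?_
    rw [Multiset.card_add, ih]
    split_ifs <;> simp

/-- A negative excursion is born at each vertex labelled `m - 1` of a component lying above the cut.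
The extra term covers the component of the root itself when it lies above, which the induction meets
in subtrees. -/
theorem card_negativeExcursions_eq {m : ℤ} {t : LabelledTree} (ht : t.HasUnitIncrements) :
    (negativeExcursions m t).card =
      (if m ≤ t.rootLabel then labelCount (m - 1) (component m t) else 0) +
        ((positiveExcursions m t).map (labelCount 0)).sum := by
  induction t with
  | node x k c ih =>
    have hs : ∀ t, labelCount 0 (shift (-(m - 1)) t) = labelCount (m - 1) t := by
      intro t
      rw [← labelCount_shift (m - 1) (-(m - 1)), add_neg_cancel]
    rw [negativeExcursions, positiveExcursions, component, labelCount, multiset_sum_map_sum,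
      Multiset.card_sum]
    have hx : (node x k c).rootLabel = x := rfl
    rw [hx]
    have key : ∀ i, (Multiset.card ((if x = m ∧ (c i).rootLabel = m - 1 then
          {shift (-m) (component m (c i))} else 0) + negativeExcursions m (c i))) =
        (if m ≤ x then labelCount (m - 1) (if (x = m - 1 ∧ (c i).rootLabel = m) ∨
          (x = m ∧ (c i).rootLabel = m - 1) then leaf (c i).rootLabel else component m (c i))
          else 0) +
        (((if x = m - 1 ∧ (c i).rootLabel = m then
          {shift (-(m - 1)) (component m (c i))} else 0) +
            positiveExcursions m (c i)).map (labelCount 0)).sum := by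
      intro i
      have hc := rootLabel_child ht i
      rw [Multiset.card_add, ih i (ht i).2, Multiset.map_add, Multiset.sum_add]
      by_cases h1 : x = m - 1 ∧ (c i).rootLabel = m
      · have h2 : ¬ (x = m ∧ (c i).rootLabel = m - 1) := by omega
        rw [if_neg h2, if_pos h1, if_pos (by omega), if_neg (by omega)]
        simp only [Multiset.map_singleton, Multiset.sum_singleton, hs, Multiset.card_zero, zero_add]
      · by_cases h2 : x = m ∧ (c i).rootLabel = m - 1
        · rw [if_pos h2, if_neg h1, if_neg (by omega), if_pos (by omega), if_pos (Or.inr h2), h2.2]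
          simp [leaf, labelCount]
        · rw [if_neg h2, if_neg h1, if_neg (not_or.2 ⟨h1, h2⟩),
            if_congr (show m ≤ (c i).rootLabel ↔ m ≤ x by omega) rfl rfl]
          simp
    rw [Finset.sum_congr rfl fun i _ => key i, Finset.sum_add_distrib]
    congr 1
    split_ifs with h1 h2
    · omega
    · simp
    · simp

theorem exists_of_mem_positiveExcursions {m : ℤ} {t A : LabelledTree} (ht : t.HasUnitIncrements)
    (hA : A ∈ positiveExcursions m t) :
    ∃ s : LabelledTree, s.HasUnitIncrements ∧ s.rootLabel = m ∧
      A = shift (-(m - 1)) (component m s) := by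
  induction t with
  | node x k c ih =>
    rw [positiveExcursions, Multiset.mem_sum] at hA
    obtain ⟨i, -, hA⟩ := hA
    rcases Multiset.mem_add.1 hA with h | h
    · split_ifs at h with hx
      · exact ⟨c i, (ht i).2, hx.2, Multiset.mem_singleton.1 h⟩
      · simp at h
    · exact ih i (ht i).2 h

theorem exists_of_mem_negativeExcursions {m : ℤ} {t A : LabelledTree} (ht : t.HasUnitIncrements)
    (hA : A ∈ negativeExcursions m t) :
    ∃ s : LabelledTree, s.HasUnitIncrements ∧ s.rootLabel = m - 1 ∧
      A = shift (-m) (component m s) := by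
  induction t with
  | node x k c ih =>
    rw [negativeExcursions, Multiset.mem_sum] at hA
    obtain ⟨i, -, hA⟩ := hA
    rcases Multiset.mem_add.1 hA with h | h
    · split_ifs at h with hx
      · exact ⟨c i, (ht i).2, hx.2, Multiset.mem_singleton.1 h⟩
      · simp at h
    · exact ih i (ht i).2 h

/-- Every edge survives in exactly one component: a cut edge stays with its parent, ending at the
leaf copy of the child. -/
theorem edgeCount_eq_add (m a b : ℤ) (t : LabelledTree) :
    edgeCount a b t = edgeCount a b (component m t) +
      ((positiveExcursions m t).map (edgeCount (a - (m - 1)) (b - (m - 1)))).sum +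
      ((negativeExcursions m t).map (edgeCount (a - m) (b - m))).sum := by
  induction t with
  | node x k c ih =>
    rw [negativeExcursions, positiveExcursions, component, multiset_sum_map_sum,
      multiset_sum_map_sum, edgeCount, edgeCount, ← Finset.sum_add_distrib,
      ← Finset.sum_add_distrib]
    refine Finset.sum_congr rfl fun i _ => ?_
    simp only [Multiset.map_add, Multiset.sum_add]
    have hr : (leaf (c i).rootLabel).rootLabel = (c i).rootLabel := rfl
    by_cases h1 : x = m - 1 ∧ (c i).rootLabel = m
    · have h2 : ¬ (x = m ∧ (c i).rootLabel = m - 1) := by omega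
      simp only [if_neg h2, if_pos h1, if_pos (Or.inl h1 : _ ∨ x = m ∧ (c i).rootLabel = m - 1), ih i,
        Multiset.map_singleton, Multiset.sum_singleton, edgeCount_shift_neg, edgeCount_leaf,
        Multiset.map_zero, Multiset.sum_zero, hr]
      ring
    · by_cases h2 : x = m ∧ (c i).rootLabel = m - 1
      · simp only [if_pos h2, if_neg h1, if_pos (Or.inr h2 : x = m - 1 ∧ (c i).rootLabel = m ∨ _),
          ih i, Multiset.map_singleton, Multiset.sum_singleton, edgeCount_shift_neg, edgeCount_leaf,
          Multiset.map_zero, Multiset.sum_zero, hr]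
        ring
      · simp only [if_neg h2, if_neg h1, if_neg (not_or.2 ⟨h1, h2⟩), ih i, rootLabel_component,
          Multiset.map_zero, Multiset.sum_zero, zero_add]
        ring

theorem edgeCount_component_of_lt {m a b : ℤ} {t : LabelledTree} (ht : t.HasUnitIncrements)
    (hm : t.rootLabel < m) (hab : m < a ∨ m < b) : edgeCount a b (component m t) = 0 := by
  induction t with
  | node x k c ih =>
    change x < m at hm
    rw [component, edgeCount]
    refine Finset.sum_eq_zero fun i _ => ?_
    have hc := rootLabel_child ht i
    split_ifs with h1 h2 h2
    · exfalso
      change x = a ∧ (c i).rootLabel = b at h2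
      omega
    · rw [edgeCount_leaf, zero_add]
    · rw [rootLabel_component] at h2
      omega
    · rw [ih i (ht i).2 (by omega), zero_add]

theorem edgeCount_component_of_le {m a b : ℤ} {t : LabelledTree} (ht : t.HasUnitIncrements)
    (hm : m ≤ t.rootLabel) (hab : a < m - 1 ∨ b < m - 1) :
    edgeCount a b (component m t) = 0 := by
  induction t with
  | node x k c ih =>
    change m ≤ x at hm
    rw [component, edgeCount]
    refine Finset.sum_eq_zero fun i _ => ?_
    have hc := rootLabel_child ht i
    split_ifs with h1 h2 h2
    · exfalso
      change x = a ∧ (c i).rootLabel = b at h2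
      omega
    · rw [edgeCount_leaf, zero_add]
    · rw [rootLabel_component] at h2
      omega
    · rw [ih i (ht i).2 (by omega), zero_add]

/-- Turns the value of `X_m^-` into the constraint on the total number of zeros of the positive
excursions. -/
theorem edgeProfile_eq {m : ℤ} {t : LabelledTree} (ht : t.HasUnitIncrements)
    (hm : t.rootLabel < m) :
    edgeProfile m t = ((positiveExcursions m t).card,
      ((positiveExcursions m t).map (labelCount 0)).sum) := by
  rw [edgeProfile, ← card_positiveExcursions, ← card_negativeExcursions,
    card_negativeExcursions_eq ht, if_neg (by omega), zero_add]

/-- The root component and the negative excursions, before shifting, have no label above `m`. -/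
theorem edgeCount_above {m a b : ℤ} {t : LabelledTree} (ht : t.HasUnitIncrements)
    (hm : t.rootLabel < m) (hab : m < a ∨ m < b) :
    edgeCount a b t =
      ((positiveExcursions m t).map (edgeCount (a - (m - 1)) (b - (m - 1)))).sum := by
  rw [edgeCount_eq_add m, edgeCount_component_of_lt ht hm hab, zero_add, Nat.add_eq_left,
    Multiset.sum_eq_zero_iff]
  intro n hn
  obtain ⟨A, hA, rfl⟩ := Multiset.mem_map.1 hn
  obtain ⟨s, hs, hsr, rfl⟩ := exists_of_mem_negativeExcursions ht hA
  rw [edgeCount_shift_neg]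
  exact edgeCount_component_of_lt hs (by omega) hab

theorem edgeCount_below {m a b : ℤ} {t : LabelledTree} (ht : t.HasUnitIncrements)
    (hm : t.rootLabel < m) (hab : a < m - 1 ∨ b < m - 1) :
    edgeCount a b t = edgeCount a b (truncate m t) +
      ((negativeExcursions m t).map (edgeCount (a - m) (b - m))).sum := by
  rw [edgeCount_eq_add m, component_eq_truncate_of_lt ht hm, add_left_inj, Nat.add_eq_left,
    Multiset.sum_eq_zero_iff]
  intro n hn
  obtain ⟨A, hA, rfl⟩ := Multiset.mem_map.1 hn
  obtain ⟨s, hs, hsr, rfl⟩ := exists_of_mem_positiveExcursions ht hA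
  rw [edgeCount_shift_neg]
  exact edgeCount_component_of_le hs (by omega) hab

/-- The edge profile at level `m + 1` is a function of the positive excursions at level `m`, which
does not depend on `m`. -/
theorem edgeProfile_succ {m : ℤ} {t : LabelledTree} (ht : t.HasUnitIncrements)
    (hm : t.rootLabel < m) :
    edgeProfile (m + 1) t = (((positiveExcursions m t).map (edgeCount 1 2)).sum,
      ((positiveExcursions m t).map (edgeCount 2 1)).sum) := by
  rw [edgeProfile, edgeCount_above ht hm (by omega), edgeCount_above ht hm (by omega)]
  rw [show m + 1 - 1 - (m - 1) = 1 by ring, show m + 1 - (m - 1) = 2 by ring]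

/-- The edge profile at a level `j < m` is a function of the part of the tree outside of the
positive excursions at level `m`. -/
theorem edgeProfile_of_lt {j m : ℤ} (hj : j < m) {t : LabelledTree} (ht : t.HasUnitIncrements)
    (hm : t.rootLabel < m) :
    edgeProfile j t = (edgeCount (j - 1) j (truncate m t) +
        ((negativeExcursions m t).map (edgeCount (j - 1 - m) (j - m))).sum,
      edgeCount j (j - 1) (truncate m t) +
        ((negativeExcursions m t).map (edgeCount (j - m) (j - 1 - m))).sum) := by
  rw [edgeProfile, edgeCount_below ht hm (by omega), edgeCount_below ht hm (by omega)]

/-! #### Marking excursions by monomials -/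

open MvPowerSeries

/-- The series of formal variables indexed by positive and negative excursions. -/
abbrev ExcursionSeries := MvPowerSeries (LabelledTree ⊕ LabelledTree) ENNReal

/-- The monomial recording the excursions of a tree at level `m`. -/
noncomputable def excursionMonomial (m : ℤ) (t : LabelledTree) : ExcursionSeries :=
  monomial (mark (positiveExcursions m t) (negativeExcursions m t)) 1

theorem monomial_mark_add {α β : Type*} (A A' : Multiset α) (B B' : Multiset β) :
    monomial (mark (A + A') (B + B')) (1 : ENNReal) =
      monomial (mark A B) 1 * monomial (mark A' B') 1 := by
  rw [mark_add, monomial_mul_monomial, one_mul]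

theorem monomial_mark_sum {α β ι : Type*} (s : Finset ι) (A : ι → Multiset α)
    (B : ι → Multiset β) :
    monomial (mark (∑ i ∈ s, A i) (∑ i ∈ s, B i)) (1 : ENNReal) =
      ∏ i ∈ s, monomial (mark (A i) (B i)) 1 := by
  classical
  induction s using Finset.induction_on with
  | empty =>
    simp only [Finset.sum_empty, Finset.prod_empty, mark_zero]
    rfl
  | insert i s hi ih =>
    rw [Finset.sum_insert hi, Finset.sum_insert hi, Finset.prod_insert hi, monomial_mark_add, ih]

/-- The monomial of a subtree attached by an edge from label `m - 1` to label `m`. -/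
noncomputable def positiveMonomial (m : ℤ) (t : LabelledTree) : ExcursionSeries :=
  X (Sum.inl (shift (-(m - 1)) (component m t))) * excursionMonomial m t

/-- The monomial of a subtree attached by an edge from label `m` to label `m - 1`. -/
noncomputable def negativeMonomial (m : ℤ) (t : LabelledTree) : ExcursionSeries :=
  X (Sum.inr (shift (-m) (component m t))) * excursionMonomial m t

theorem excursionMonomial_node (m x : ℤ) (k : ℕ) (c : Fin k → LabelledTree) :
    excursionMonomial m (node x k c) = ∏ i,
      if x = m - 1 ∧ (c i).rootLabel = m then positiveMonomial m (c i)
      else if x = m ∧ (c i).rootLabel = m - 1 then negativeMonomial m (c i)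
      else excursionMonomial m (c i) := by
  rw [excursionMonomial, positiveExcursions, negativeExcursions, monomial_mark_sum]
  refine Finset.prod_congr rfl fun i _ => ?_
  rw [monomial_mark_add]
  split_ifs with h1 h2 h2
  · omega
  · rw [mark_singleton_left]
    rfl
  · rw [mark_singleton_right]
    rfl
  · rw [mark_zero]
    exact one_mul _

/-- The product of a function over the subtrees hanging from the first vertices with label `l`. -/
noncomputable def cutProd {M : Type*} [CommMonoid M] (l : ℤ) (φ : LabelledTree → M) :
    LabelledTree → M
  | node x k c => if x = l then φ (node x k c) else ∏ i, cutProd l φ (c i)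

theorem cutProd_of_rootLabel_eq {M : Type*} [CommMonoid M] {l : ℤ} (φ : LabelledTree → M)
    {t : LabelledTree} (h : t.rootLabel = l) : cutProd l φ t = φ t := by
  cases t with
  | node x k c =>
    change x = l at h
    rw [cutProd, if_pos h]

/-- The only cut edges met before label `m` is reached are those reaching it, so the marks factor
over the subtrees resummed in `infSum_truncate`. -/
theorem excursionMonomial_of_lt {m : ℤ} {t : LabelledTree} (ht : t.HasUnitIncrements)
    (hm : t.rootLabel < m) : excursionMonomial m t = cutProd m (positiveMonomial m) t := by
  induction t with
  | node x k c ih =>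
    change x < m at hm
    rw [excursionMonomial_node, cutProd, if_neg (by omega)]
    refine Finset.prod_congr rfl fun i _ => ?_
    have hc := rootLabel_child ht i
    split_ifs with h1 h2
    · rw [cutProd_of_rootLabel_eq _ h1.2]
    · omega
    · exact ih i (ht i).2 (by omega)

theorem excursionMonomial_of_le {m : ℤ} {t : LabelledTree} (ht : t.HasUnitIncrements)
    (hm : m ≤ t.rootLabel) :
    excursionMonomial m t = cutProd (m - 1) (negativeMonomial m) t := by
  induction t with
  | node x k c ih =>
    change m ≤ x at hm
    rw [excursionMonomial_node, cutProd, if_neg (by omega)]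
    refine Finset.prod_congr rfl fun i _ => ?_
    have hc := rootLabel_child ht i
    split_ifs with h1 h2
    · omega
    · rw [cutProd_of_rootLabel_eq _ h2.2]
    · exact ih i (ht i).2 (by omega)

end LabelledTree

/-! ### The branching property at a truncation level -/

theorem MvPowerSeries.infSum_injective {σ ι κ : Type*} {g : κ → ι} (hg : Function.Injective g)
    (f : ι → MvPowerSeries σ ENNReal) (hf : ∀ i, i ∉ Set.range g → f i = 0) :
    MvPowerSeries.infSum f = MvPowerSeries.infSum fun j => f (g j) := by
  ext n
  simp only [MvPowerSeries.coeff_infSum]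
  refine (hg.tsum_eq (f := fun i => MvPowerSeries.coeff n (f i)) fun i hi => ?_).symm
  by_contra h
  rw [Function.mem_support, hf i h, map_zero] at hi
  exact hi rfl

namespace LabelledTree

open MvPowerSeries

theorem node_injective (x : ℤ) (k : ℕ) : Function.Injective (node x k) := by
  intro c c' h
  simpa using h

/-- The underlying tree, labelled by pairs (label, number of children). -/
def toWType : LabelledTree → WType fun a : ℤ × ℕ => Fin a.2
  | node x k c => WType.mk (x, k) fun i => toWType (c i)

theorem toWType_injective : Function.Injective toWType := by
  intro t
  induction t with
  | node x k c ih =>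
    rintro ⟨x', k', c'⟩ h
    rw [toWType, toWType, WType.mk.injEq, Prod.mk.injEq] at h
    obtain ⟨⟨rfl, rfl⟩, h⟩ := h
    congr 1
    ext1 i
    exact ih i (congrFun (eq_of_heq h) i)

instance : Countable LabelledTree := toWType_injective.countable

variable (ξ : PMF ℕ) (η : (k : ℕ) → PMF (Fin k → ℤ))

/-- Allows sums over all trees: those violating the increment constraint have weight zero. -/
theorem hasUnitIncrements_of_weight_ne_zero
    (hη : ∀ k, ∀ d ∈ (η k).support, ∀ i, d i ∈ ({-1, 0, 1} : Set ℤ)) {t : LabelledTree}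
    (ht : weight ξ η t ≠ 0) : t.HasUnitIncrements := by
  induction t with
  | node x k c ih =>
    rw [weight, mul_ne_zero_iff, mul_ne_zero_iff, Finset.prod_ne_zero_iff] at ht
    exact fun i => ⟨hη k _ ((PMF.mem_support_iff _ _).2 ht.1.2) i, ih i (ht.2 i (Finset.mem_univ i))⟩

/-- The sum of a function over the labelled Galton–Watson trees rooted at `x`. -/
noncomputable def rootedSum (x : ℤ) (φ : LabelledTree → ExcursionSeries) : ExcursionSeries :=
  infSum fun t => if t.rootLabel = x then weight ξ η t • φ t else 0

/-- The mass of a truncated tree. -/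
noncomputable def truncateWeight (l : ℤ) : LabelledTree → ENNReal
  | node x k c => if x = l then (if k = 0 then 1 else 0) else
      ξ k * η k (fun i => (c i).rootLabel - x) * ∏ i, truncateWeight l (c i)

-- This is the branching property: with the truncation fixed, the subtrees at its vertices labelled
-- `l` vary freely, each contributing one factor `rootedSum`. The induction distributes the sum over
-- the children by `prod_infSum`.
open Classical in
theorem infSum_truncate_eq (l : ℤ) (φ : LabelledTree → ExcursionSeries) (τ : LabelledTree) :
    (infSum fun t => if truncate l t = τ then weight ξ η t • cutProd l φ t else 0) =
      truncateWeight ξ η l τ • rootedSum ξ η l φ ^ labelCount l τ := by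
  induction τ with
  | node x k c ih =>
    by_cases hx : x = l
    · subst hx
      rw [truncateWeight, if_pos rfl]
      have hroot : ∀ t, truncate x t = node x k c → t.rootLabel = x := by
        intro t ht
        rw [← rootLabel_truncate x t, ht]
        rfl
      -- A truncated tree has no children below label `l`, so for `k ≠ 0` both sides vanish.
      by_cases hk : k = 0
      · subst hk
        have hc : c = Fin.elim0 := by
          ext1 i
          exact i.elim0
        have h : ∀ t, truncate x t = node x 0 c ↔ t.rootLabel = x := by
          refine fun t => ⟨hroot t, fun ht => ?_⟩
          rw [truncate_of_rootLabel_eq ht, hc]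
          rfl
        rw [if_pos rfl, one_smul, labelCount, if_pos rfl]
        simp only [Finset.univ_eq_empty, Finset.sum_empty, add_zero, pow_one, rootedSum, h]
        congr 1
        ext1 t
        split_ifs with ht
        · rw [cutProd_of_rootLabel_eq _ ht]
        · rfl
      · rw [if_neg hk, zero_smul]
        ext n
        rw [coeff_infSum, coeff_zero, ENNReal.tsum_eq_zero]
        intro t
        rw [if_neg, coeff_zero]
        intro ht
        rw [truncate_of_rootLabel_eq (hroot t ht), leaf, node.injEq] at ht
        exact hk ht.2.1.symm
    · have htr : ∀ c' : Fin k → LabelledTree, truncate l (node x k c') = node x k c ↔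
          ∀ i, truncate l (c' i) = c i := by
        intro c'
        rw [truncate, if_neg hx, (node_injective x k).eq_iff, funext_iff]
      rw [infSum_injective (node_injective x k)]
      · have hterm : ∀ c' : Fin k → LabelledTree,
            (if truncate l (node x k c') = node x k c then
              weight ξ η (node x k c') • cutProd l φ (node x k c') else 0) =
            (ξ k * η k (fun i => (c i).rootLabel - x)) • ∏ i,
              (if truncate l (c' i) = c i then weight ξ η (c' i) • cutProd l φ (c' i) else 0) := by
          intro c'
          by_cases h : ∀ i, truncate l (c' i) = c i
          · rw [if_pos ((htr c').2 h), weight, cutProd, if_neg hx]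
            simp only [h, if_true]
            rw [Finset.prod_smul, smul_smul]
            congr 4
            ext1 i
            rw [← h i, rootLabel_truncate]
          · rw [if_neg fun h' => h ((htr c').1 h')]
            push Not at h
            obtain ⟨i, hi⟩ := h
            rw [Finset.prod_eq_zero (Finset.mem_univ i) (if_neg hi), smul_zero]
        simp only [hterm]
        rw [← smul_infSum, ← prod_infSum fun (i : Fin k) t =>
          if truncate l t = c i then weight ξ η t • cutProd l φ t else 0]
        simp only [ih]
        rw [Finset.prod_smul, smul_smul, truncateWeight, if_neg hx, labelCount, if_neg hx, zero_add,
          Finset.prod_pow_eq_pow_sum]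
      · rintro ⟨x', k', c'⟩ ht
        rw [if_neg]
        intro h
        rw [truncate] at h
        split_ifs at h with hx'
        · rw [leaf, node.injEq] at h
          exact hx (h.1.symm.trans hx')
        · rw [node.injEq] at h
          obtain ⟨rfl, rfl, -⟩ := h
          exact ht ⟨c', rfl⟩

open Classical in
/-- The probability that the truncation at level `l` of a Galton–Watson tree is `τ`. -/
noncomputable def truncateMass (l : ℤ) (τ : LabelledTree) : ENNReal :=
  ∑' t, if truncate l t = τ then weight ξ η t else 0

theorem truncateMass_shift (l s : ℤ) (τ : LabelledTree) :
    truncateMass ξ η (l + s) (shift s τ) = truncateMass ξ η l τ := by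
  classical
  rw [truncateMass, ← (shiftEquiv s).tsum_eq]
  refine tsum_congr fun t => ?_
  change (if truncate (l + s) (shift s t) = shift s τ then weight ξ η (shift s t) else 0) = _
  rw [truncate_shift, weight_shift]
  have := (shiftEquiv s).injective.eq_iff (a := truncate l t) (b := τ)
  change shift s _ = shift s _ ↔ _ at this
  simp only [this]

theorem tsum_rootLabel_eq (x y : ℤ) :
    (∑' t : LabelledTree, if t.rootLabel = x then weight ξ η t else 0) =
      ∑' t : LabelledTree, if t.rootLabel = y then weight ξ η t else 0 := by
  rw [← (shiftEquiv (x - y)).tsum_eq]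
  refine tsum_congr fun t => ?_
  change (if (shift (x - y) t).rootLabel = x then weight ξ η (shift (x - y) t) else 0) = _
  rw [rootLabel_shift, weight_shift]
  refine if_congr ?_ rfl rfl
  omega

variable {ξ η}
-- The branching property with `φ = 1`: each resummed subtree has total mass one, by `h1`.
theorem truncateMass_eq
    (h1 : (∑' t : LabelledTree, if t.rootLabel = 0 then weight ξ η t else 0) = 1)
    (l : ℤ) (τ : LabelledTree) :
    truncateMass ξ η l τ = truncateWeight ξ η l τ := by
  classical
  have hcut : ∀ t, cutProd l (fun _ => (1 : ExcursionSeries)) t = 1 := by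
    intro t
    induction t with
    | node x k c ih =>
      rw [cutProd]
      split_ifs
      · rfl
      · exact Finset.prod_eq_one fun i _ => ih i
  have hone : rootedSum ξ η l (fun _ => 1) = 1 := by
    ext n
    rw [rootedSum, coeff_infSum]
    have : ∀ t : LabelledTree,
        coeff n (if t.rootLabel = l then weight ξ η t • (1 : ExcursionSeries) else 0) =
        (if t.rootLabel = l then weight ξ η t else 0) * coeff n 1 := by
      intro t
      split_ifs
      · rw [coeff_smul]
      · simp
    simp only [this]
    rw [ENNReal.tsum_mul_right, tsum_rootLabel_eq ξ η l 0, h1, one_mul]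
  have h := congrArg (coeff 0) (infSum_truncate_eq ξ η l (fun _ => 1) τ)
  rw [hone, one_pow, coeff_smul, coeff_zero_one, mul_one, coeff_infSum] at h
  rw [← h, truncateMass]
  refine tsum_congr fun t => ?_
  rw [hcut]
  split_ifs
  · rw [coeff_smul, coeff_zero_one, mul_one]
  · rw [coeff_zero]

open Classical in
theorem infSum_truncate
    (h1 : (∑' t : LabelledTree, if t.rootLabel = 0 then weight ξ η t else 0) = 1)
    (l : ℤ) (φ : LabelledTree → ExcursionSeries) (τ : LabelledTree) :
    (infSum fun t => if truncate l t = τ then weight ξ η t • cutProd l φ t else 0) =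
      truncateMass ξ η l τ • rootedSum ξ η l φ ^ labelCount l τ := by
  rw [infSum_truncate_eq, truncateMass_eq h1]

/-! ### The two-type equations for excursions and the joint law -/

variable (ξ η) in
/-- The law of the truncation at level `0` of a Galton–Watson tree rooted at `x`. -/
noncomputable def excursionMass (x : ℤ) (τ : LabelledTree) : ENNReal :=
  if τ.rootLabel = x then truncateMass ξ η 0 τ else 0

/-- Trees are grouped by their truncation `a`, shifted so that the cut level becomes `0`. The
variable depends on `a` alone, and the branching property sums the rest. -/
theorem rootedSum_X_mul_cutProd
    (h1 : (∑' t : LabelledTree, if t.rootLabel = 0 then weight ξ η t else 0) = 1)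
    (x l : ℤ) (v : LabelledTree → LabelledTree ⊕ LabelledTree)
    (φ : LabelledTree → ExcursionSeries) :
    rootedSum ξ η x (fun t => X (v (shift (-l) (truncate l t))) * cutProd l φ t) =
      infSum fun a => excursionMass ξ η (x - l) a •
        (X (v a) * rootedSum ξ η l φ ^ labelCount 0 a) := by
  classical
  rw [rootedSum, infSum_fiberwise fun t => shift (-l) (truncate l t)]
  congr 1
  ext1 a
  have hshift : ∀ t, shift (-l) (truncate l t) = a ↔ truncate l t = shift l a := fun t =>
    (shiftEquiv l).symm_apply_eq (x := truncate l t) (y := a)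
  have hmass := truncateMass_shift ξ η 0 l a
  have hcount := labelCount_shift 0 l a
  rw [zero_add] at hmass hcount
  rw [excursionMass]
  split_ifs with ha
  · rw [← hmass, ← hcount, ← mul_smul_comm, ← infSum_truncate h1, mul_infSum]
    congr 1
    ext1 t
    rw [if_congr (hshift t) rfl rfl]
    split_ifs with ht hr
    · rw [(hshift t).2 ht, mul_smul_comm]
    · exfalso
      apply hr
      rw [← rootLabel_truncate l t, ht, rootLabel_shift, ha]
      ring
    · rw [mul_zero]
  · rw [zero_smul]
    ext n
    rw [coeff_infSum, coeff_zero, ENNReal.tsum_eq_zero]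
    intro t
    rw [if_congr (hshift t) rfl rfl]
    split_ifs with ht hr
    · exfalso
      apply ha
      rw [← rootLabel_truncate l t, ht, rootLabel_shift] at hr
      omega
    · rw [coeff_zero]
    · rw [coeff_zero]

theorem rootedSum_congr (hη : ∀ k, ∀ d ∈ (η k).support, ∀ i, d i ∈ ({-1, 0, 1} : Set ℤ))
    (x : ℤ) {φ ψ : LabelledTree → ExcursionSeries}
    (h : ∀ t : LabelledTree, t.HasUnitIncrements → t.rootLabel = x → φ t = ψ t) :
    rootedSum ξ η x φ = rootedSum ξ η x ψ := by
  rw [rootedSum, rootedSum]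
  congr 1
  ext1 t
  split_ifs with hx
  · by_cases ht : weight ξ η t = 0
    · rw [ht, zero_smul, zero_smul]
    · rw [h t (hasUnitIncrements_of_weight_ne_zero ξ η hη ht) hx]
  · rfl

theorem rootedSum_positiveMonomial
    (h1 : (∑' t : LabelledTree, if t.rootLabel = 0 then weight ξ η t else 0) = 1)
    (hη : ∀ k, ∀ d ∈ (η k).support, ∀ i, d i ∈ ({-1, 0, 1} : Set ℤ)) (m : ℤ) :
    rootedSum ξ η m (positiveMonomial m) = infSum fun a => excursionMass ξ η 1 a •
      (X (Sum.inl a) * rootedSum ξ η (m - 1) (negativeMonomial m) ^ labelCount 0 a) := by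
  have h := rootedSum_X_mul_cutProd h1 m (m - 1) Sum.inl (negativeMonomial m)
  rw [sub_sub_cancel] at h
  rw [← h]
  refine rootedSum_congr hη m fun t ht hm => ?_
  rw [positiveMonomial, component_eq_truncate_of_le ht hm.ge, excursionMonomial_of_le ht hm.ge]

theorem rootedSum_negativeMonomial
    (h1 : (∑' t : LabelledTree, if t.rootLabel = 0 then weight ξ η t else 0) = 1)
    (hη : ∀ k, ∀ d ∈ (η k).support, ∀ i, d i ∈ ({-1, 0, 1} : Set ℤ)) (m : ℤ) :
    rootedSum ξ η (m - 1) (negativeMonomial m) = infSum fun b => excursionMass ξ η (-1) b •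
      (X (Sum.inr b) * rootedSum ξ η m (positiveMonomial m) ^ labelCount 0 b) := by
  have h := rootedSum_X_mul_cutProd h1 (m - 1) m Sum.inr (positiveMonomial m)
  rw [show m - 1 - m = -1 by ring] at h
  rw [← h]
  refine rootedSum_congr hη (m - 1) fun t ht hm => ?_
  have hm' : t.rootLabel < m := by omega
  rw [negativeMonomial, component_eq_truncate_of_lt ht hm', excursionMonomial_of_lt ht hm']

open Classical in
/-- The joint law of the positive excursions, the root component and the negative excursions. -/
theorem exists_joint_law
    (h1 : (∑' t : LabelledTree, if t.rootLabel = 0 then weight ξ η t else 0) = 1)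
    (hη : ∀ k, ∀ d ∈ (η k).support, ∀ i, d i ∈ ({-1, 0, 1} : Set ℤ))
    {m : ℤ} (hm : 0 < m) :
    ∃ G : ℕ → ℕ → LabelledTree × Multiset LabelledTree → ENNReal,
      ∀ (A : Multiset LabelledTree) (z : LabelledTree × Multiset LabelledTree),
        (∑' t : LabelledTree, if positiveExcursions m t = A ∧
            (truncate m t, negativeExcursions m t) = z then
            (if t.rootLabel = 0 then weight ξ η t else 0) else 0) =
          multisetMass (excursionMass ξ η 1) A.card A * G A.card (A.map (labelCount 0)).sum z := by
  obtain ⟨H, hH⟩ := exists_coeff_two_type (rootedSum_positiveMonomial h1 hη m)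
    (rootedSum_negativeMonomial h1 hη m)
  -- The root component `z.1` has its own mass, and each of its vertices labelled `m` roots one
  -- positive excursion, whence `r = labelCount m z.1`.
  refine ⟨fun p q z => (if z.1.rootLabel = 0 then truncateMass ξ η m z.1 else 0) *
    H (labelCount m z.1) p q z.2, ?_⟩
  rintro A ⟨τ, B⟩
  rw [mul_left_comm, ← hH]
  dsimp only
  split_ifs with hτ
  · rw [← coeff_smul, ← infSum_truncate h1, coeff_infSum]
    refine tsum_congr fun t => ?_
    simp only [Prod.mk.injEq]
    by_cases ht : truncate m t = τ
    · have hr : t.rootLabel = 0 := by rw [← rootLabel_truncate m t, ht, hτ]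
      rw [if_pos ht, if_pos hr]
      by_cases hw : weight ξ η t = 0
      · simp [hw]
      · have hu := hasUnitIncrements_of_weight_ne_zero ξ η hη hw
        rw [coeff_smul, ← excursionMonomial_of_lt hu (by omega), excursionMonomial, coeff_monomial]
        simp only [mark_inj, ht, true_and, mul_ite, mul_one, mul_zero, eq_comm (a := A),
          eq_comm (a := B)]
    · rw [if_neg ht, if_neg (by tauto), coeff_zero]
  · rw [zero_mul, ENNReal.tsum_eq_zero]
    intro t
    split_ifs with h hr
    · exfalso
      apply hτ
      rw [Prod.mk.injEq] at h
      rw [← h.2.1, rootLabel_truncate, hr]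
    · rfl
    · rfl

end LabelledTree

/-! ### Unordered independent samples -/

/-- Identifies `multisetMass` with the law of the unordered sample, by grouping ordered samples
according to their multiset. -/
theorem measure_pi_map_univ_mem {α : Type*} [Countable α] [MeasurableSpace α]
    [MeasurableSingletonClass α] (ρ : Measure α) [IsProbabilityMeasure ρ] (p : ℕ)
    (s : Set (Multiset α)) :
    (Measure.pi fun _ : Fin p => ρ) {τ | Finset.univ.val.map τ ∈ s} =
      ∑' A : Multiset α, s.indicator (multisetMass (fun a => ρ {a}) p) A := by
  classical
  rw [← Measure.tsum_indicator_apply_singleton _ _ (Set.to_countable _).measurableSet]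
  have h : ∀ A : Multiset α, s.indicator (multisetMass (fun a => ρ {a}) p) A =
      ∑' τ : Fin p → α, if Finset.univ.val.map τ = A then
        (if A ∈ s then ∏ i, ρ {τ i} else 0) else 0 := by
    intro A
    rw [Set.indicator_apply]
    split_ifs with hA
    · rfl
    · simp
  simp only [h]
  rw [ENNReal.tsum_comm]
  refine tsum_congr fun τ => ?_
  rw [tsum_eq_single (Finset.univ.val.map τ) fun A hA => if_neg hA.symm, if_pos rfl,
    Set.indicator_apply, Measure.pi_singleton]
  rfl

theorem multisetMass_eq_zero_of_card_ne {α : Type*} (μ : α → ENNReal) {p : ℕ} {A : Multiset α}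
    (h : A.card ≠ p) : multisetMass μ p A = 0 := by
  rw [multisetMass, ENNReal.tsum_eq_zero]
  intro τ
  rw [if_neg]
  rintro rfl
  simp at h

namespace LabelledTree

instance : DiscreteMeasurableSpace LabelledTree := ⟨fun _ => MeasurableSpace.measurableSet_top⟩

/-! ### The law of the Galton–Watson tree -/

section Law

variable {ξ : PMF ℕ} {η : (k : ℕ) → PMF (Fin k → ℤ)}

theorem galtonWatsonLaw_apply (hη : ∀ k, ∀ d ∈ (η k).support, ∀ i, d i ∈ ({-1, 0, 1} : Set ℤ))
    (x : ℤ) (D : Set LabelledTree) :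
    galtonWatsonLaw ξ η x D =
      ∑' t : LabelledTree, D.indicator (fun t => if t.rootLabel = x then weight ξ η t else 0) t := by
  classical
  rw [galtonWatsonLaw, Measure.restrict_apply .of_discrete, Measure.sum_apply _ .of_discrete]
  refine tsum_congr fun t => ?_
  rw [Measure.smul_apply, Measure.dirac_apply' _ .of_discrete, smul_eq_mul, Set.indicator_apply,
    Set.indicator_apply]
  by_cases ht : weight ξ η t = 0
  · simp [ht]
  · have hu := hasUnitIncrements_of_weight_ne_zero ξ η hη ht
    have : t ∈ D ∩ rootedAt x ↔ t ∈ D ∧ t.rootLabel = x := by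
      simp [rootedAt, hu]
    rw [if_congr this rfl rfl]
    by_cases h1 : t ∈ D <;> by_cases h2 : t.rootLabel = x <;> simp [h1, h2]

theorem positiveExcursionLaw_singleton
    (hη : ∀ k, ∀ d ∈ (η k).support, ∀ i, d i ∈ ({-1, 0, 1} : Set ℤ)) (a : LabelledTree) :
    positiveExcursionLaw ξ η {a} = excursionMass ξ η 1 a := by
  classical
  rw [positiveExcursionLaw, Measure.map_apply .of_discrete .of_discrete,
    galtonWatsonLaw_apply hη, excursionMass]
  split_ifs with ha
  · refine tsum_congr fun t => ?_
    rw [Set.indicator_apply]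
    change (if truncate 0 t = a then _ else _) = _
    split_ifs with h h'
    · rfl
    · exfalso
      rw [← h, rootLabel_truncate] at ha
      exact h' ha
    · rfl
  · rw [ENNReal.tsum_eq_zero]
    intro t
    rw [Set.indicator_apply]
    change (if truncate 0 t = a then _ else _) = _
    split_ifs with h h'
    · exfalso
      rw [← h, rootLabel_truncate] at ha
      exact ha h'
    · rfl
    · rfl

theorem isProbabilityMeasure_positiveExcursionLaw
    (h1 : (∑' t : LabelledTree, if t.rootLabel = 0 then weight ξ η t else 0) = 1)
    (hη : ∀ k, ∀ d ∈ (η k).support, ∀ i, d i ∈ ({-1, 0, 1} : Set ℤ)) :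
    IsProbabilityMeasure (positiveExcursionLaw ξ η) := by
  constructor
  rw [positiveExcursionLaw, Measure.map_apply .of_discrete .of_discrete,
    galtonWatsonLaw_apply hη]
  simp only [Set.preimage_univ, Set.indicator_univ]
  rw [tsum_rootLabel_eq ξ η 1 0, h1]

/-- The samples of `p` positive excursions with `q` vertices of label `0` in total. -/
def balancedSamples (p q : ℕ) : Set (Fin p → LabelledTree) :=
  {τ | ∑ i, labelCount 0 (τ i) = q}

/-- On the event that the edge profile at level `m` is `(p, q)`, the joint law of the positive
excursions and of the rest of the tree is a product measure. -/
theorem exists_galtonWatsonLaw_eq_mul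
    (h1 : (∑' t : LabelledTree, if t.rootLabel = 0 then weight ξ η t else 0) = 1)
    (hη : ∀ k, ∀ d ∈ (η k).support, ∀ i, d i ∈ ({-1, 0, 1} : Set ℤ))
    {m : ℤ} (hm : 0 < m) (p q : ℕ) :
    ∃ g : Set (LabelledTree × Multiset LabelledTree) → ENNReal,
      ∀ (s : Set (Multiset LabelledTree)) (D : Set (LabelledTree × Multiset LabelledTree)),
        galtonWatsonLaw ξ η 0 {t | edgeProfile m t = (p, q) ∧ positiveExcursions m t ∈ s ∧
            (truncate m t, negativeExcursions m t) ∈ D} =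
          (Measure.pi fun _ : Fin p => positiveExcursionLaw ξ η)
            (balancedSamples p q ∩ {τ | Finset.univ.val.map τ ∈ s}) * g D := by
  classical
  have := isProbabilityMeasure_positiveExcursionLaw h1 hη
  obtain ⟨G, hG⟩ := exists_joint_law h1 hη hm
  refine ⟨fun D => ∑' z, D.indicator (G p q) z, fun s D => ?_⟩
  have hpi : balancedSamples p q ∩ {τ | Finset.univ.val.map τ ∈ s} =
      {τ : Fin p → LabelledTree |
        Finset.univ.val.map τ ∈ {A | (A.map (labelCount 0)).sum = q ∧ A ∈ s}} := by
    ext τ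
    rw [Set.mem_inter_iff, Set.mem_ofPred_eq, Set.mem_ofPred_eq, Set.mem_ofPred_eq, Multiset.map_map]
    rfl
  rw [hpi, measure_pi_map_univ_mem, galtonWatsonLaw_apply hη]
  simp only [positiveExcursionLaw_singleton hη]
  rw [← ENNReal.tsum_mul_right]
  -- Expands the product over pairs `(A, z)` to apply the joint law termwise. The condition `A.card
  -- = p` may be added because `multisetMass` vanishes for other sizes.
  have hz : ∀ A : Multiset LabelledTree, Set.indicator
      {A | (A.map (labelCount 0)).sum = q ∧ A ∈ s} (multisetMass (excursionMass ξ η 1) p) A *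
        ∑' z, D.indicator (G p q) z =
      ∑' z, ∑' t : LabelledTree, if positiveExcursions m t = A ∧
          (truncate m t, negativeExcursions m t) = z then
          (if A.card = p ∧ (A.map (labelCount 0)).sum = q ∧ A ∈ s ∧ z ∈ D then
            (if t.rootLabel = 0 then weight ξ η t else 0) else 0) else 0 := by
    intro A
    rw [← ENNReal.tsum_mul_left]
    refine tsum_congr fun z => ?_
    by_cases hA : A.card = p ∧ (A.map (labelCount 0)).sum = q ∧ A ∈ s ∧ z ∈ D
    · simp only [if_pos hA]
      rw [hG, Set.indicator_of_mem (by exact ⟨hA.2.1, hA.2.2.1⟩), Set.indicator_of_mem hA.2.2.2,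
        hA.1, hA.2.1]
    · simp only [if_neg hA, ite_self, tsum_zero]
      by_cases hp : A.card = p
      · by_cases hs : (A.map (labelCount 0)).sum = q ∧ A ∈ s
        · rw [Set.indicator_of_notMem (fun hz : z ∈ D => hA ⟨hp, hs.1, hs.2, hz⟩), mul_zero]
        · rw [Set.indicator_of_notMem (by exact hs), zero_mul]
      · rw [Set.indicator_apply, multisetMass_eq_zero_of_card_ne _ hp, ite_self, zero_mul]
  simp only [hz]
  rw [← ENNReal.tsum_prod (f := fun A z => ∑' t : LabelledTree, if positiveExcursions m t = A ∧
          (truncate m t, negativeExcursions m t) = z then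
          (if A.card = p ∧ (A.map (labelCount 0)).sum = q ∧ A ∈ s ∧ z ∈ D then
            (if t.rootLabel = 0 then weight ξ η t else 0) else 0) else 0), ENNReal.tsum_comm]
  refine tsum_congr fun t => ?_
  rw [tsum_eq_single (positiveExcursions m t, (truncate m t, negativeExcursions m t)),
    if_pos ⟨rfl, rfl⟩,
    Set.indicator_apply]
  · by_cases hr : t.rootLabel = 0
    · by_cases hw : weight ξ η t = 0
      · simp [hw]
      · have hu := hasUnitIncrements_of_weight_ne_zero ξ η hη hw
        refine if_congr ?_ rfl rfl
        rw [Set.mem_ofPred_eq, edgeProfile_eq hu (by omega), Prod.mk.injEq, and_assoc]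
    · simp [hr]
  · rintro ⟨A, z⟩ h
    rw [if_neg]
    rintro ⟨rfl, rfl⟩
    exact h rfl

end Law

/-! ### The transition kernel of the edge profiles -/

/-- The edge profile at the next level, as a function of the positive excursions. -/
def nextProfile (A : Multiset LabelledTree) : ℕ × ℕ :=
  ((A.map (edgeCount 1 2)).sum, (A.map (edgeCount 2 1)).sum)

/-- The edge profile at level `j`, as a function of the root component and of the negative
excursions at a level `m > j`. -/
def previousProfile (m j : ℤ) (z : LabelledTree × Multiset LabelledTree) : ℕ × ℕ :=
  (edgeCount (j - 1) j z.1 + (z.2.map (edgeCount (j - 1 - m) (j - m))).sum,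
    edgeCount j (j - 1) z.1 + (z.2.map (edgeCount (j - m) (j - 1 - m))).sum)

/-- The law of the edge profile at the next level, given that the profile is `x`. -/
noncomputable def nextProfileLaw (ρ : Measure LabelledTree) (x : ℕ × ℕ) : Measure (ℕ × ℕ) :=
  ((Measure.pi fun _ : Fin x.1 => ρ)[|balancedSamples x.1 x.2]).map
    fun τ => nextProfile (Finset.univ.val.map τ)

/-- The transition kernel of the edge profiles. -/
noncomputable def profileKernel (ρ : Measure LabelledTree) (x : ℕ × ℕ) : PMF (ℕ × ℕ) :=
  open Classical in
  -- If the balanced samples have mass zero, conditioning gives the zero measure; the default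
  -- `PMF.pure 0` concerns states that are visited with probability zero.
  if _ : IsProbabilityMeasure (nextProfileLaw ρ x) then (nextProfileLaw ρ x).toPMF else PMF.pure 0

theorem profileKernel_apply {ρ : Measure LabelledTree} [IsProbabilityMeasure ρ] {p q : ℕ}
    (h : (Measure.pi fun _ : Fin p => ρ) (balancedSamples p q) ≠ 0) (y : ℕ × ℕ) :
    profileKernel ρ (p, q) y =
      ((Measure.pi fun _ : Fin p => ρ) (balancedSamples p q))⁻¹ *
        (Measure.pi fun _ : Fin p => ρ)
          (balancedSamples p q ∩ {τ | nextProfile (Finset.univ.val.map τ) = y}) := by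
  have := cond_isProbabilityMeasure h
  have hmeas : Measurable fun τ : Fin p → LabelledTree => nextProfile (Finset.univ.val.map τ) :=
    fun s _ => (Set.to_countable _).measurableSet
  have hp := Measure.isProbabilityMeasure_map
    (μ := (Measure.pi fun _ : Fin p => ρ)[|balancedSamples p q]) hmeas.aemeasurable
  change IsProbabilityMeasure (nextProfileLaw ρ (p, q)) at hp
  rw [profileKernel, dif_pos hp, Measure.toPMF_apply, nextProfileLaw,
    Measure.map_apply hmeas (measurableSet_singleton y),
    cond_apply (Set.to_countable _).measurableSet]
  rfl

end LabelledTree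

/-! ### Conditional independence, conditional law and Markov property -/

open LabelledTree in
theorem theorem4p2
    (ξ : PMF ℕ) (hξ : ∑' k : ℕ, ξ k * (k : ENNReal) ≤ 1) (hξ1 : ξ 1 ≠ 1)
    (η : (k : ℕ) → PMF (Fin k → ℤ))
    (hη : ∀ k, ∀ d ∈ (η k).support, ∀ i, d i ∈ ({-1, 0, 1} : Set ℤ))
    {Ω : Type*} [MeasurableSpace Ω] (P : Measure Ω) [IsProbabilityMeasure P]
    (T : Ω → LabelledTree) (hT : Measurable T) (hlaw : P.map T = galtonWatsonLaw ξ η 0) :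
    (∀ m : ℕ, 1 ≤ m → ∀ p q : ℕ, P {ω | edgeProfile m (T ω) = (p, q)} ≠ 0 →
      IndepFun (fun ω => positiveExcursions m (T ω))
          (fun ω => (truncate m (T ω), negativeExcursions m (T ω)))
          (P[|{ω | edgeProfile m (T ω) = (p, q)}]) ∧
        (P[|{ω | edgeProfile m (T ω) = (p, q)}]).map (fun ω => positiveExcursions m (T ω)) =
          ((Measure.pi fun _ : Fin p => positiveExcursionLaw ξ η)[|
              {τ : Fin p → LabelledTree | ∑ i, labelCount 0 (τ i) = q}]).map
            (fun τ => Finset.univ.val.map τ)) ∧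
      IsTimeHomogeneousMarkovChain P (fun k ω => edgeProfile ((k : ℤ) + 1) (T ω)) := by
  classical
  have hP : ∀ D : Set LabelledTree, P {ω | T ω ∈ D} = galtonWatsonLaw ξ η 0 D := by
    intro D
    rw [← hlaw, Measure.map_apply hT .of_discrete]
    rfl
  have hmeas : ∀ D : Set LabelledTree, MeasurableSet {ω | T ω ∈ D} := fun D => hT .of_discrete
  -- That the weights of finite trees sum to one is read off from `hlaw`, as `P` has total mass one.
  have h1 : (∑' t : LabelledTree, if t.rootLabel = 0 then weight ξ η t else 0) = 1 := by
    have h := hP Set.univ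
    rw [galtonWatsonLaw_apply hη, Set.indicator_univ] at h
    rw [← h]
    simp
  have hprob := isProbabilityMeasure_positiveExcursionLaw h1 hη
  have hfactor : ∀ {m : ℤ}, 0 < m → ∀ p q : ℕ,
      ∃ g : Set (LabelledTree × Multiset LabelledTree) → ENNReal,
        ∀ (s : Set (Multiset LabelledTree)) (D : Set (LabelledTree × Multiset LabelledTree)),
        P {ω | edgeProfile m (T ω) = (p, q) ∧ positiveExcursions m (T ω) ∈ s ∧
            (truncate m (T ω), negativeExcursions m (T ω)) ∈ D} =
          (Measure.pi fun _ : Fin p => positiveExcursionLaw ξ η)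
            (balancedSamples p q ∩ {τ | Finset.univ.val.map τ ∈ s}) * g D := by
    intro m hm p q
    obtain ⟨g, hg⟩ := exists_galtonWatsonLaw_eq_mul h1 hη hm p q
    exact ⟨g, fun s D => (hP _).trans (hg s D)⟩
  refine ⟨fun m hm p q hE => ?_, profileKernel (positiveExcursionLaw ξ η), fun n s y hE => ?_⟩
  · obtain ⟨g, hg⟩ := hfactor (m := m) (by omega) p q
    set π := Measure.pi fun _ : Fin p => positiveExcursionLaw ξ η
    have hall : P {ω | edgeProfile m (T ω) = (p, q)} = π (balancedSamples p q) * g Set.univ := by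
      simpa using hg Set.univ Set.univ
    have hC : π (balancedSamples p q) ≠ 0 := fun h => hE (by rw [hall, h, zero_mul])
    have hg0 : g Set.univ ≠ 0 := fun h => hE (by rw [hall, h, mul_zero])
    have hC' : π (balancedSamples p q) ≠ ⊤ := measure_ne_top _ _
    have hg' : g Set.univ ≠ ⊤ := by
      intro h
      rw [h, ENNReal.mul_top hC] at hall
      exact measure_ne_top _ _ hall
    have hEm : MeasurableSet {ω | edgeProfile m (T ω) = (p, q)} :=
      hmeas {t | edgeProfile m t = (p, q)}
    -- Taking all possible values for the rest of the tree, the factor `g Set.univ` cancels in the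
    -- conditional probability.
    have hpos : ∀ s : Set (Multiset LabelledTree), P[(fun ω => positiveExcursions m (T ω)) ⁻¹' s |
        {ω | edgeProfile m (T ω) = (p, q)}] = (π (balancedSamples p q))⁻¹ *
          π (balancedSamples p q ∩ {τ | Finset.univ.val.map τ ∈ s}) := by
      intro s
      have h := hg s Set.univ
      simp only [Set.mem_univ, and_true] at h
      rw [cond_apply hEm, hall, ENNReal.mul_inv (Or.inl hC) (Or.inl hC')]
      change _ * P {ω | edgeProfile m (T ω) = (p, q) ∧ positiveExcursions m (T ω) ∈ s} = _
      rw [h, mul_assoc, mul_left_comm (g Set.univ)⁻¹, ENNReal.inv_mul_cancel hg0 hg', mul_one]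
    refine ⟨?_, ?_⟩
    · rw [IndepFun_iff]
      rintro _ _ ⟨s, -, rfl⟩ ⟨D, -, rfl⟩
      have hD := hg Set.univ D
      simp only [Set.mem_univ, true_and, Set.ofPred_true, Set.inter_univ] at hD
      rw [hpos, cond_apply hEm, cond_apply hEm, hall,
        ENNReal.mul_inv (Or.inl hC) (Or.inl hC')]
      change _ * P {ω | edgeProfile m (T ω) = (p, q) ∧ positiveExcursions m (T ω) ∈ s ∧
        (truncate m (T ω), negativeExcursions m (T ω)) ∈ D} = _ * (_ *
        P {ω | edgeProfile m (T ω) = (p, q) ∧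
          (truncate m (T ω), negativeExcursions m (T ω)) ∈ D})
      rw [hg, hD]
      have h2 : (π (balancedSamples p q))⁻¹ * π (balancedSamples p q) = 1 :=
        ENNReal.inv_mul_cancel hC hC'
      generalize π (balancedSamples p q ∩ _) = a
      calc _ = ((π (balancedSamples p q))⁻¹ * a) * ((g Set.univ)⁻¹ * g D) := by ring
        _ = ((π (balancedSamples p q))⁻¹ * a) * (((π (balancedSamples p q))⁻¹ *
            π (balancedSamples p q)) * ((g Set.univ)⁻¹ * g D)) := by rw [h2, one_mul]
        _ = _ := by ring
    · ext s -
      have hm1 : Measurable fun τ : Fin p → LabelledTree => Finset.univ.val.map τ :=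
        fun s _ => (Set.to_countable _).measurableSet
      have hs : MeasurableSet s := MeasurableSpace.measurableSet_top
      have hm2 : Measurable fun ω => positiveExcursions m (T ω) :=
        (Measurable.of_discrete (f := positiveExcursions m)).comp hT
      rw [Measure.map_apply hm2 hs, Measure.map_apply hm1 hs, hpos,
        cond_apply (Set.to_countable _).measurableSet]
      rfl
  · obtain ⟨g, hg⟩ := hfactor (m := (n : ℤ) + 1) (by omega) (s n).1 (s n).2
    -- Index `n` of the chain is level `n + 1`. The strict past is an event on the rest of the tree
    -- at that level.
    set D : Set (LabelledTree × Multiset LabelledTree) :=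
      {z | ∀ i < n, previousProfile ((n : ℤ) + 1) ((i : ℤ) + 1) z = s i}
    set π := Measure.pi fun _ : Fin (s n).1 => positiveExcursionLaw ξ η
    have hgood : ∀ᵐ ω ∂P, (T ω).HasUnitIncrements ∧ (T ω).rootLabel = 0 := by
      have h : ∀ᵐ t ∂(P.map T), t ∈ rootedAt 0 := by
        rw [hlaw, galtonWatsonLaw]
        exact ae_restrict_mem .of_discrete
      exact ae_of_ae_map hT.aemeasurable h
    -- The equivalence holds for trees with unit increments rooted at `0`, hence only almost surely.
    have hpast : ∀ᵐ ω ∂P, (∀ i ≤ n, edgeProfile ((i : ℤ) + 1) (T ω) = s i) ↔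
        edgeProfile ((n : ℤ) + 1) (T ω) = ((s n).1, (s n).2) ∧
          (truncate ((n : ℤ) + 1) (T ω), negativeExcursions ((n : ℤ) + 1) (T ω)) ∈ D := by
      filter_upwards [hgood] with ω hω
      have hprev : ∀ i < n, edgeProfile ((i : ℤ) + 1) (T ω) =
          previousProfile ((n : ℤ) + 1) ((i : ℤ) + 1)
            (truncate ((n : ℤ) + 1) (T ω), negativeExcursions ((n : ℤ) + 1) (T ω)) :=
        fun i hi => edgeProfile_of_lt (by omega) hω.1 (by omega)
      constructor
      · exact fun h => ⟨h n le_rfl, fun i hi => (hprev i hi).symm.trans (h i hi.le)⟩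
      · rintro ⟨hn, hD⟩ i hi
        rcases hi.lt_or_eq with hi | rfl
        · exact (hprev i hi).trans (hD i hi)
        · exact hn
    have hden : P {ω | ∀ i ≤ n, edgeProfile ((i : ℤ) + 1) (T ω) = s i} =
        π (balancedSamples (s n).1 (s n).2) * g D := by
      have h := hg Set.univ D
      simp only [Set.mem_univ, true_and, Set.ofPred_true, Set.inter_univ] at h
      rw [← h]
      refine measure_congr ?_
      filter_upwards [hpast] with ω hω using propext hω
    -- The next profile is an event on the positive excursions, so the past enters both numerator
    -- and denominator through the same factor `g D`, which cancels.
    have hnum : P ({ω | ∀ i ≤ n, edgeProfile ((i : ℤ) + 1) (T ω) = s i} ∩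
        {ω | edgeProfile (((n + 1 : ℕ) : ℤ) + 1) (T ω) = y}) =
        π (balancedSamples (s n).1 (s n).2 ∩
          {τ | nextProfile (Finset.univ.val.map τ) = y}) * g D := by
      rw [show {τ : Fin (s n).1 → LabelledTree | nextProfile (Finset.univ.val.map τ) = y} =
        {τ | Finset.univ.val.map τ ∈ {A | nextProfile A = y}} from rfl, ← hg]
      refine measure_congr ?_
      filter_upwards [hpast, hgood] with ω hω hω'
      refine propext ?_
      change ((∀ i ≤ n, edgeProfile ((i : ℤ) + 1) (T ω) = s i) ∧
        edgeProfile (((n + 1 : ℕ) : ℤ) + 1) (T ω) = y) ↔ _ ∧ nextProfile _ = y ∧ _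
      rw [hω, Nat.cast_succ, edgeProfile_succ hω'.1 (by omega : (T ω).rootLabel < (n : ℤ) + 1)]
      change (_ ∧ nextProfile _ = y) ↔ _
      tauto
    have hC : π (balancedSamples (s n).1 (s n).2) ≠ 0 := fun h => hE (by rw [hden, h, zero_mul])
    have hg0 : g D ≠ 0 := fun h => hE (by rw [hden, h, mul_zero])
    have hC' : π (balancedSamples (s n).1 (s n).2) ≠ ⊤ := measure_ne_top _ _
    have hg' : g D ≠ ⊤ := by
      intro h
      rw [h, ENNReal.mul_top hC] at hden
      exact measure_ne_top _ _ hden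
    have hEm : MeasurableSet {ω | ∀ i ≤ n, edgeProfile ((i : ℤ) + 1) (T ω) = s i} :=
      hmeas {t | ∀ i ≤ n, edgeProfile ((i : ℤ) + 1) t = s i}
    have hk := profileKernel_apply hC y
    rw [Prod.mk.eta] at hk
    rw [cond_apply hEm, hnum, hden, hk,
      ENNReal.mul_inv (Or.inl hC) (Or.inl hC'), mul_assoc, mul_left_comm (g D)⁻¹,
      ENNReal.inv_mul_cancel hg0 hg', mul_one]
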